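/- Let $X$ be a compact metric space with Borel $\sigma$-algebra $\mathcal B_X$, let $T$ be an action of the additive group $\mathbb Z^2$ on $X$ by homeomorphisms $T^{(m,n)}$, and let $\mu$ be a $T$-invariant Borel probability measure. Let $\vec v=(1,\beta)$ with $\beta\in\mathbb R$. For $b>0$ put $$\Lambda^{\vec v}(b)=\{(m,n)\in\mathbb Z^2:\ \beta m-b/2\le n\le \beta m+b/2\}.$$ Let $U_T^{(m,n)}f=f\circ T^{(m,n)}$ on $L^2(X,\mathcal B_X,\mu)$. Fix $b_0>0$ (arbitrary) and let $$\mathcal K_\mu^{\vec v}=\bigl\{B\in\mathcal B_X:\ \overline{\{U_T^{(m,n)}1_B:(m,n)\in\Lambda^{\vec v}(b_0)\}}\text{ is compact in }L^2(X,\mathcal B_X,\mu)\bigr\}.$$ The system $(X,\mathcal B_X,\mu,T)$ is called $\vec v$-weak mixing if $\mathcal K_\mu^{\vec v}=\{X,\emptyset\}$ up to null sets, i.e. every $B\in\mathcal K_\mu^{\vec v}$ has $\mu(B)\in\{0,1\}$. For a finite measurable partition $\alpha$ of $X$ let $H_\mu(\alpha)=-\sum_{A\in\alpha}\mu(A)\log\mu(A)$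 (with $0\log 0=0$), and for a sequence $S=\{(m_i,n_i)\}_{i=1}^\infty$ in $\mathbb Z^2$ let $$h^S_\mu(T,\alpha)=\limsup_{k\to\infty}\frac1k H_\mu\Bigl(\bigvee_{i=1}^k T^{-(m_i,n_i)}\alpha\Bigr).$$ **Theorem.** For every $b\in(0,\infty)$ (independently of $b_0$) the following are equivalent. (a) $(X,\mathcal B_X,\mu,T)$ is $\vec v$-weak mixing. (b) There is an infinite sequence $S=\{(m_i,n_i)\}_{i=1}^\infty$ of elements of $\Lambda^{\vec v}(b)$, with $\{m_i\}_{i=1}^\infty$ strictly monotone, such that $h^S_\mu(T,\alpha)=H_\mu(\alpha)$ for every finite measurable partition $\alpha$ of $X$. -/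

import Mathlib

open MeasureTheory Filter

noncomputable section

namespace DirectionalWeakMixing

/-- The strip `{(m, n) ∈ ℤ² : β m - b / 2 ≤ n ≤ β m + b / 2}` of width `b` around the line in
direction `(1, β)`. -/
def strip (β b : ℝ) : Set (ℤ × ℤ) :=
  {g | β * (g.1 : ℝ) - b / 2 ≤ (g.2 : ℝ) ∧ (g.2 : ℝ) ≤ β * (g.1 : ℝ) + b / 2}

/-- An infinite sequence of elements of the strip whose first coordinates are strictly monotone
(strictly increasing or strictly decreasing). -/
def IsStripSequence (β b : ℝ) (S : ℕ → ℤ × ℤ) : Prop :=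
  (∀ i, S i ∈ strip β b) ∧
    (StrictMono (fun i => (S i).1) ∨ StrictAnti (fun i => (S i).1))

/-- A measurable partition of `X` with cells indexed by `ι`. Empty cells are allowed; they do not
change the entropy, because `0 log 0 = 0`. -/
structure MeasurablePartition (ι X : Type*) [MeasurableSpace X] where
  cell : ι → Set X
  measurableSet_cell : ∀ i, MeasurableSet (cell i)
  disjoint_cell : ∀ i j, i ≠ j → Disjoint (cell i) (cell j)
  iUnion_cell : ⋃ i, cell i = Set.univ

namespace MeasurablePartition

variable {ι J X : Type*} [MeasurableSpace X]

/-- The partition into the sets `f⁻¹ A`, for `A` a cell of `α`. -/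
def comap (α : MeasurablePartition ι X) (f : X → X) (hf : Measurable f) :
    MeasurablePartition ι X where
  cell i := f ⁻¹' α.cell i
  measurableSet_cell i := hf (α.measurableSet_cell i)
  disjoint_cell i j hij := (α.disjoint_cell i j hij).preimage f
  iUnion_cell := by rw [← Set.preimage_iUnion, α.iUnion_cell, Set.preimage_univ]

/-- The join `⋁ⱼ αⱼ` of finitely many partitions: its cells are the intersections `⋂ⱼ Aⱼ` with
`Aⱼ` a cell of `αⱼ`. -/
def join [Finite J] (α : J → MeasurablePartition ι X) : MeasurablePartition (J → ι) X where
  cell w := ⋂ j, (α j).cell (w j)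
  measurableSet_cell w := MeasurableSet.iInter fun j => (α j).measurableSet_cell (w j)
  disjoint_cell w w' h := by
    obtain ⟨j, hj⟩ := Function.ne_iff.mp h
    exact ((α j).disjoint_cell _ _ hj).mono (Set.iInter_subset _ j) (Set.iInter_subset _ j)
  iUnion_cell := by
    refine Set.eq_univ_of_forall fun x => ?_
    have hx : ∀ j, ∃ i, x ∈ (α j).cell i := fun j => by
      have := Set.mem_univ x
      rwa [← (α j).iUnion_cell, Set.mem_iUnion] at this
    choose w hw using hx
    exact Set.mem_iUnion.mpr ⟨w, Set.mem_iInter.mpr hw⟩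

/-- The entropy `H_μ(α) = -∑_{A ∈ α} μ(A) log μ(A)` of a finite measurable partition. -/
def entropy [Fintype ι] (μ : Measure X) (α : MeasurablePartition ι X) : ℝ :=
  ∑ i, Real.negMulLog (μ.real (α.cell i))

end MeasurablePartition

section System

variable {X : Type*} [MeasurableSpace X] [AddAction (ℤ × ℤ) X] [MeasurableConstVAdd (ℤ × ℤ) X]

/-- `⋁ᵢ T^{-(mᵢ, nᵢ)} α` over the first `k` terms of the sequence `S`, where `T^g x = g +ᵥ x`. -/
def sequenceJoin {ι : Type*} (α : MeasurablePartition ι X) (S : ℕ → ℤ × ℤ) (k : ℕ) :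
    MeasurablePartition (Fin k → ι) X :=
  MeasurablePartition.join fun i : Fin k =>
    α.comap (fun x => S i +ᵥ x) (measurable_const_vadd (S i))

/-- The sequence entropy `h^S_μ(T, α) = limsup_k (1 / k) H_μ(⋁_{i ≤ k} T^{-(mᵢ, nᵢ)} α)`,
with the upper limit taken in the extended reals. -/
def sequenceEntropy {ι : Type*} [Fintype ι] (μ : Measure X) (α : MeasurablePartition ι X)
    (S : ℕ → ℤ × ℤ) : EReal :=
  limsup (fun k : ℕ => (((sequenceJoin α S k).entropy μ / (k : ℝ) : ℝ) : EReal)) atTop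

/-- The Koopman operator `U_T^g f = f ∘ T^g` on `L²(X, μ)`. -/
def koopman (μ : Measure X) [VAddInvariantMeasure (ℤ × ℤ) X μ] (g : ℤ × ℤ) :
    Lp ℂ 2 μ →ₗᵢ[ℂ] Lp ℂ 2 μ :=
  Lp.compMeasurePreservingₗᵢ ℂ (fun x => g +ᵥ x) (measurePreserving_vadd g μ)

/-- The directional Kronecker algebra in direction `(1, β)`, defined with the strip of width `b`:
the measurable sets `B` for which the closure of `{U_T^g 1_B : g ∈ strip β b}` is compact
in `L²(X, μ)`. -/
def kroneckerAlgebra (μ : Measure X) [IsFiniteMeasure μ] [VAddInvariantMeasure (ℤ × ℤ) X μ]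
    (β b : ℝ) : Set (Set X) :=
  {B | ∃ hB : MeasurableSet B, IsCompact (closure
    ((fun g => koopman μ g (indicatorConstLp 2 hB (measure_ne_top μ B) (1 : ℂ))) '' strip β b))}

/-- Weak mixing in direction `(1, β)`: the directional Kronecker algebra, defined with the strip of
width `b`, is trivial, that is, it is `{X, ∅}` up to sets of measure zero. -/
def IsWeakMixing (μ : Measure X) [IsFiniteMeasure μ] [VAddInvariantMeasure (ℤ × ℤ) X μ]
    (β b : ℝ) : Prop :=
  ∀ B ∈ kroneckerAlgebra μ β b, B =ᵐ[μ] (∅ : Set X) ∨ B =ᵐ[μ] (Set.univ : Set X)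

end System

end DirectionalWeakMixing

end

/-! Both implications compare sets with precompact orbit along the strip to sets whose translates
decorrelate.

From (b) to (a): if `B` has precompact orbit, then up to small measure the translates of `B` along
`S` are among finitely many fixed ones. Rokhlin's estimate bounds the entropy of the `k`-fold join
of `{B, Bᶜ}` by a constant plus `k * ε`. The sequence entropy is therefore zero, and so is the
entropy of `{B, Bᶜ}` (`isWeakMixing_of_sequence`).

From (a) to (b): for a vector `f`, let `A_w` be the weak average of the rank one operators `x ↦ ⟪U g
f, x⟫ U g f` over a strip with offset `w` (`stripOp`). It is positive with trace at most `‖f‖²`,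
hence compact. Moreover `U g (A_w x) = A_{w₁} (U g x)`, where `w₁ = w - n + β m` for `g = (m, n)`
stays in a bounded interval as `g` runs over a strip. The columns carry tent weights that make `w ↦
A_w` Lipschitz, so each `A_w x` has precompact orbit. If `h` is orthogonal to all vectors with
precompact orbit, then `⟪A_w h, h⟫ = 0`, which says that `|⟪h, U g f⟫|²` averages to zero
(`tendsto_avg_correlation`).

Under weak mixing, vectors with precompact orbit are constant, since the superlevel sets of their
real and imaginary parts lie in the Kronecker algebra. Taking `h = 1_C - μ(C)` and `f = 1_A` gives
one filter inside the strip along which all pairs of sets mix (`exists_mixing_filter`). Choosing the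
terms of `S` greedily along this filter makes each new translate almost independent of the past, for
a countable dense family of partitions. Continuity of entropy extends the conclusion to all finite
partitions. -/

noncomputable section

namespace DirectionalWeakMixing

/-! ### Entropy of finite-valued functions: submodularity, Rokhlin's estimate, continuity. -/

section Entropy

open Real Finset

set_option linter.unusedSectionVars false

lemma negMulLog_add_le {a b : ℝ} (ha : 0 ≤ a) (hb : 0 ≤ b) :
    negMulLog (a + b) ≤ negMulLog a + negMulLog b := by
  rcases ha.eq_or_lt with rfl | ha
  · simp
  rcases hb.eq_or_lt with rfl | hb
  · simp
  have h1 := Real.log_le_log ha (le_add_of_nonneg_right hb.le)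
  have h2 := Real.log_le_log hb (le_add_of_nonneg_left ha.le)
  simp only [negMulLog]
  nlinarith

lemma negMulLog_sum_le {ι : Type*} (s : Finset ι) (p : ι → ℝ) (hp : ∀ i, 0 ≤ p i) :
    negMulLog (∑ i ∈ s, p i) ≤ ∑ i ∈ s, negMulLog (p i) := by
  classical
  induction s using Finset.induction_on with
  | empty => simp
  | insert i s hi ih =>
    rw [sum_insert hi, sum_insert hi]
    exact (negMulLog_add_le (hp i) (sum_nonneg fun j _ => hp j)).trans (by gcongr)

/-- Subadditivity of entropy for unnormalised tables. -/
lemma sum_negMulLog_add_le {ι κ : Type*} [Fintype ι] [Fintype κ] (Q : ι → κ → ℝ)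
    (hQ : ∀ x y, 0 ≤ Q x y) :
    ∑ x, ∑ y, negMulLog (Q x y) + negMulLog (∑ x, ∑ y, Q x y) ≤
      ∑ x, negMulLog (∑ y, Q x y) + ∑ y, negMulLog (∑ x, Q x y) := by
  set s := ∑ x, ∑ y, Q x y with hs
  set a : ι → ℝ := fun x => ∑ y, Q x y with ha
  set b : κ → ℝ := fun y => ∑ x, Q x y with hb
  have ha0 : ∀ x, 0 ≤ a x := fun x => sum_nonneg fun y _ => hQ x y
  have hb0 : ∀ y, 0 ≤ b y := fun y => sum_nonneg fun x _ => hQ x y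
  have hs0 : 0 ≤ s := sum_nonneg fun x _ => ha0 x
  have hQa : ∀ x y, Q x y ≤ a x := fun x y =>
    single_le_sum (f := fun y => Q x y) (fun y _ => hQ x y) (mem_univ y)
  have hQb : ∀ x y, Q x y ≤ b y := fun x y =>
    single_le_sum (f := fun x => Q x y) (fun x _ => hQ x y) (mem_univ x)
  have has : ∀ x, a x ≤ s := fun x => single_le_sum (fun x _ => ha0 x) (mem_univ x)
  have hsb : ∑ y, b y = s := by rw [hs, sum_comm]
  have key : ∀ x y, negMulLog (Q x y) - Q x y * log s + Q x y * log (a x) + Q x y * log (b y) ≤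
      a x * b y / s - Q x y := by
    intro x y
    rcases (hQ x y).eq_or_lt with h | h
    · rw [← h]
      simp only [negMulLog_zero, zero_mul, sub_zero, add_zero]
      exact div_nonneg (mul_nonneg (ha0 x) (hb0 y)) hs0
    · have ax := h.trans_le (hQa x y)
      have bx := h.trans_le (hQb x y)
      have sx := ax.trans_le (has x)
      -- The inequality `log t ≤ t - 1` at the ratio of the product of the marginals to the joint
      -- weight. Summed over the table, the right side of `key` vanishes.
      have hl := Real.log_le_sub_one_of_pos (x := a x * b y / (Q x y * s)) (by positivity)
      rw [Real.log_div (by positivity) (by positivity), Real.log_mul ax.ne' bx.ne',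
        Real.log_mul h.ne' sx.ne'] at hl
      have := mul_le_mul_of_nonneg_left hl h.le
      have e : Q x y * (a x * b y / (Q x y * s) - 1) = a x * b y / s - Q x y := by
        field_simp
      rw [e] at this
      simp only [negMulLog]
      linarith
  have hsum := sum_le_sum fun x (_ : x ∈ univ) => sum_le_sum fun y (_ : y ∈ univ) => key x y
  simp only [sum_add_distrib, sum_sub_distrib] at hsum
  have e1 : ∑ x, ∑ y, a x * b y / s = s := by
    simp_rw [← sum_div, ← mul_sum, hsb, ← sum_mul]
    rcases hs0.eq_or_lt with h | h
    · rw [← h]; simp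
    · rw [show ∑ x, a x = s from rfl]; field_simp
  have e2 : ∑ x, ∑ y, Q x y * log s = - negMulLog s := by
    simp_rw [← sum_mul]
    rw [show ∑ x, ∑ y, Q x y = s from rfl]
    simp [negMulLog]
  have e3 : ∑ x, ∑ y, Q x y * log (a x) = - ∑ x, negMulLog (a x) := by
    simp_rw [← sum_mul]; simp [negMulLog, ha]
  have e4 : ∑ x, ∑ y, Q x y * log (b y) = - ∑ y, negMulLog (b y) := by
    rw [sum_comm]; simp_rw [← sum_mul]; simp [negMulLog, hb]
  rw [e1, e2, e3, e4] at hsum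
  linarith

variable {X ι κ τ : Type*} [MeasurableSpace X]

/-- The entropy of a finite-valued random variable. -/
def ent [Fintype ι] (μ : Measure X) (Y : X → ι) : ℝ :=
  ∑ i, negMulLog (μ.real (Y ⁻¹' {i}))

variable [Fintype ι] [MeasurableSpace ι] [MeasurableSingletonClass ι]
  [Fintype κ] [MeasurableSpace κ] [MeasurableSingletonClass κ]
  [Fintype τ] [MeasurableSpace τ] [MeasurableSingletonClass τ]
  (μ : Measure X) [IsProbabilityMeasure μ]

lemma real_preimage_comp [DecidableEq κ] {Y : X → ι} (hY : Measurable Y) (f : ι → κ) (k : κ) :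
    μ.real ((fun x => f (Y x)) ⁻¹' {k}) = ∑ i with f i = k, μ.real (Y ⁻¹' {i}) := by
  have : (fun x => f (Y x)) ⁻¹' {k} = ⋃ i ∈ univ.filter (fun i => f i = k), Y ⁻¹' {i} := by
    ext x; simp
  rw [this, measureReal_biUnion_finset]
  · intro i _ j _ hij
    exact Disjoint.preimage _ (by simpa using hij)
  · exact fun i _ => hY (measurableSet_singleton i)

lemma ent_comp_le {Y : X → ι} (hY : Measurable Y) (f : ι → κ) :
    ent μ (fun x => f (Y x)) ≤ ent μ Y := by
  classical
  unfold ent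
  rw [← sum_fiberwise univ f]
  refine sum_le_sum fun k _ => ?_
  rw [real_preimage_comp μ hY]
  exact negMulLog_sum_le _ _ fun i => measureReal_nonneg

lemma ent_congr_of_comp {Y : X → ι} {Z : X → κ} (hY : Measurable Y) (hZ : Measurable Z)
    (f : ι → κ) (g : κ → ι) (hf : ∀ x, f (Y x) = Z x) (hg : ∀ x, g (Z x) = Y x) :
    ent μ Y = ent μ Z := by
  apply le_antisymm
  · simpa only [hg] using ent_comp_le μ hZ g
  · simpa only [hf] using ent_comp_le μ hY f

lemma ent_le_card {Y : X → ι} : ent μ Y ≤ Fintype.card ι := by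
  unfold ent
  refine (sum_le_sum fun i _ => ?_ : _ ≤ ∑ i : ι, (1 : ℝ)).trans (by simp)
  have h0 : 0 ≤ μ.real (Y ⁻¹' {i}) := measureReal_nonneg
  have h1 : μ.real (Y ⁻¹' {i}) ≤ 1 := measureReal_le_one
  rcases h0.eq_or_lt with h | h
  · rw [← h]; simp
  · have := Real.one_sub_inv_le_log_of_pos h
    have h3 : μ.real (Y ⁻¹' {i}) * (1 - (μ.real (Y ⁻¹' {i}))⁻¹) = μ.real (Y ⁻¹' {i}) - 1 := by
      field_simp
    have := mul_le_mul_of_nonneg_left this h0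
    rw [h3] at this
    simp only [negMulLog]
    linarith

lemma ent_nonneg {Y : X → ι} : 0 ≤ ent μ Y :=
  sum_nonneg fun _ _ => negMulLog_nonneg measureReal_nonneg measureReal_le_one

/-- Strong subadditivity. -/
lemma ent_submodular {Y : X → ι} {Z : X → κ} {W : X → τ} (hY : Measurable Y) (hZ : Measurable Z)
    (hW : Measurable W) :
    ent μ (fun x => (Y x, Z x, W x)) + ent μ W ≤
      ent μ (fun x => (Y x, W x)) + ent μ (fun x => (Z x, W x)) := by
  classical
  have hT : Measurable (fun x => (Y x, Z x, W x)) := hY.prodMk (hZ.prodMk hW)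
  set P : ι → κ → τ → ℝ := fun i k t => μ.real ((fun x => (Y x, Z x, W x)) ⁻¹' {(i, k, t)}) with hP
  have hsum : ∀ (q : ι × κ × τ → ℝ), ∑ p, q p = ∑ t, ∑ i, ∑ k, q (i, k, t) := by
    intro q
    rw [Fintype.sum_prod_type]
    simp_rw [Fintype.sum_prod_type]
    conv_lhs => enter [2, i]; rw [sum_comm]
    rw [sum_comm]
  have e1 : ent μ (fun x => (Y x, Z x, W x)) = ∑ t, ∑ i, ∑ k, negMulLog (P i k t) := by
    unfold ent; rw [hsum]
  have e2 : ent μ W = ∑ t, negMulLog (∑ i, ∑ k, P i k t) := by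
    unfold ent
    refine sum_congr rfl fun t _ => congrArg _ ?_
    have := real_preimage_comp μ hT (fun p => p.2.2) t
    rw [this, sum_filter, hsum]
    rw [sum_eq_single t (by intro t' _ h; simp [h]) (by simp)]
    simp [hP]
  have e3 : ent μ (fun x => (Y x, W x)) = ∑ t, ∑ i, negMulLog (∑ k, P i k t) := by
    unfold ent
    rw [Fintype.sum_prod_type, sum_comm]
    refine sum_congr rfl fun t _ => sum_congr rfl fun i _ => congrArg _ ?_
    have := real_preimage_comp μ hT (fun p => (p.1, p.2.2)) (i, t)
    rw [this, sum_filter, hsum]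
    rw [sum_eq_single t (by intro t' _ h; simp [h]) (by simp),
      sum_eq_single i (by intro t' _ h; simp [h]) (by simp)]
    simp [hP]
  have e4 : ent μ (fun x => (Z x, W x)) = ∑ t, ∑ k, negMulLog (∑ i, P i k t) := by
    unfold ent
    rw [Fintype.sum_prod_type, sum_comm]
    refine sum_congr rfl fun t _ => sum_congr rfl fun k _ => congrArg _ ?_
    have := real_preimage_comp μ hT (fun p => (p.2.1, p.2.2)) (k, t)
    rw [this, sum_filter, hsum]
    rw [sum_eq_single t (by intro t' _ h; simp [h]) (by simp)]
    refine sum_congr rfl fun i _ => ?_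
    rw [sum_eq_single k (by intro t' _ h; simp [h]) (by simp)]
    simp [hP]
  rw [e1, e2, e3, e4, ← sum_add_distrib, ← sum_add_distrib]
  -- Each slice `W = t` is an unnormalised table, with total mass the probability of that slice.
  exact sum_le_sum fun t _ => sum_negMulLog_add_le (fun i k => P i k t)
    fun _ _ => measureReal_nonneg

lemma ent_of_subsingleton [Subsingleton ι] (W : X → ι) : ent μ W = 0 := by
  refine sum_eq_zero fun i _ => ?_
  have : W ⁻¹' {i} = Set.univ := by
    ext x
    simpa using Subsingleton.elim _ _
  simp [this]

lemma ent_comp_measurePreserving {Y : X → ι} (hY : ∀ i, MeasurableSet (Y ⁻¹' {i})) {f : X → X}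
    (hf : MeasurePreserving f μ μ) : ent μ (fun x => Y (f x)) = ent μ Y :=
  sum_congr rfl fun i _ => congrArg _ (hf.measureReal_preimage (hY i).nullMeasurableSet)

/-- The conditional entropy `H(Y | Z)`. -/
def condEnt (μ : Measure X) (Y : X → ι) (Z : X → κ) : ℝ :=
  ent μ (fun x => (Y x, Z x)) - ent μ Z

lemma condEnt_comp_measurePreserving {Y : X → ι} {Z : X → κ} (hY : Measurable Y)
    (hZ : Measurable Z) {f : X → X} (hf : MeasurePreserving f μ μ) :
    condEnt μ (fun x => Y (f x)) (fun x => Z (f x)) = condEnt μ Y Z := by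
  unfold condEnt
  rw [ent_comp_measurePreserving μ (fun i => hZ (measurableSet_singleton i)) hf,
    ← ent_comp_measurePreserving μ (Y := fun x => (Y x, Z x))
      (fun i => (hY.prodMk hZ) (measurableSet_singleton i)) hf]

lemma ent_le_ent_add_condEnt {Y : X → ι} {Z : X → κ} (hY : Measurable Y) (hZ : Measurable Z) :
    ent μ Y ≤ ent μ Z + condEnt μ Y Z := by
  have := ent_comp_le μ (hY.prodMk hZ) Prod.fst
  simp only [condEnt]
  linarith

/-- Subadditivity conditional on `(Z, Z')`, followed by dropping `Z'` from the first condition and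
`Z` from the second; all three are cases of submodularity. -/
lemma condEnt_pair_le {ι' κ' : Type*} [Fintype ι'] [MeasurableSpace ι']
    [MeasurableSingletonClass ι'] [Fintype κ'] [MeasurableSpace κ'] [MeasurableSingletonClass κ']
    {Y : X → ι} {Z : X → κ} {Y' : X → ι'} {Z' : X → κ'} (hY : Measurable Y) (hZ : Measurable Z)
    (hY' : Measurable Y') (hZ' : Measurable Z') :
    condEnt μ (fun x => (Y x, Y' x)) (fun x => (Z x, Z' x)) ≤ condEnt μ Y Z + condEnt μ Y' Z' := by
  have h1 := ent_submodular μ hY hY' (hZ.prodMk hZ')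
  have h2 := ent_submodular μ hY hZ' hZ
  have h3 := ent_submodular μ hY' hZ hZ'
  have e1 : ent μ (fun x => (Y x, Z x, Z' x)) = ent μ (fun x => (Y x, Z' x, Z x)) :=
    ent_congr_of_comp μ (hY.prodMk (hZ.prodMk hZ')) (hY.prodMk (hZ'.prodMk hZ))
      (fun p => (p.1, p.2.2, p.2.1)) (fun p => (p.1, p.2.2, p.2.1)) (fun _ => rfl) fun _ => rfl
  have e2 : ent μ (fun x => (Z x, Z' x)) = ent μ (fun x => (Z' x, Z x)) :=
    ent_congr_of_comp μ (hZ.prodMk hZ') (hZ'.prodMk hZ) Prod.swap Prod.swap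
      (fun _ => rfl) fun _ => rfl
  have e3 : ent μ (fun x => ((Y x, Y' x), Z x, Z' x)) = ent μ (fun x => (Y x, Y' x, Z x, Z' x)) :=
    ent_congr_of_comp μ ((hY.prodMk hY').prodMk (hZ.prodMk hZ'))
      (hY.prodMk (hY'.prodMk (hZ.prodMk hZ')))
      (fun p => (p.1.1, p.1.2, p.2)) (fun p => ((p.1, p.2.1), p.2.2)) (fun _ => rfl) fun _ => rfl
  simp only [condEnt]
  linarith

lemma ent_fin_succ {Y : ℕ → X → ι} (hY : ∀ j, Measurable (Y j)) (k : ℕ) :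
    ent μ (fun x (j : Fin (k + 1)) => Y j x) = ent μ (fun x => (fun j : Fin k => Y j x, Y k x)) := by
  refine ent_congr_of_comp μ (measurable_pi_lambda _ fun j => hY j)
    (Measurable.prodMk (measurable_pi_lambda (fun x (j : Fin k) => Y j x) fun j => hY j) (hY k))
    (fun v => (fun j => v j.castSucc, v (Fin.last k)))
    (fun p => Fin.snoc (α := fun _ => ι) p.1 p.2) (fun x => ?_) fun x => ?_
  · simp
  · funext j
    refine Fin.lastCases ?_ (fun j => ?_) j <;> simp

lemma condEnt_fin_le {Y : ℕ → X → ι} {Z : ℕ → X → κ} (hY : ∀ j, Measurable (Y j))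
    (hZ : ∀ j, Measurable (Z j)) (k : ℕ) :
    condEnt μ (fun x (j : Fin k) => Y j x) (fun x (j : Fin k) => Z j x) ≤
      ∑ j ∈ range k, condEnt μ (Y j) (Z j) := by
  induction k with
  | zero =>
    simp [condEnt, ent_of_subsingleton]
  | succ k ih =>
    rw [sum_range_succ]
    have hYk : Measurable (fun x (j : Fin k) => Y j x) := measurable_pi_lambda _ fun j => hY j
    have hZk : Measurable (fun x (j : Fin k) => Z j x) := measurable_pi_lambda _ fun j => hZ j
    have h := condEnt_pair_le μ hYk hZk (hY k) (hZ k)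
    have e : condEnt μ (fun x (j : Fin (k + 1)) => Y j x) (fun x (j : Fin (k + 1)) => Z j x) =
        condEnt μ (fun x => (fun j : Fin k => Y j x, Y k x))
          (fun x => (fun j : Fin k => Z j x, Z k x)) := by
      unfold condEnt
      rw [ent_fin_succ μ hZ]
      congr 1
      refine ent_congr_of_comp μ
        (Measurable.prodMk (measurable_pi_lambda _ fun j => hY j)
          (measurable_pi_lambda _ fun j => hZ j))
        ((hYk.prodMk (hY k)).prodMk (hZk.prodMk (hZ k)))
        (fun v => ((fun j => v.1 j.castSucc, v.1 (Fin.last k)),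
          (fun j => v.2 j.castSucc, v.2 (Fin.last k))))
        (fun p => (Fin.snoc (α := fun _ => ι) p.1.1 p.1.2, Fin.snoc (α := fun _ => κ) p.2.1 p.2.2))
        (fun x => ?_) fun x => ?_
      · simp
      · refine Prod.ext ?_ ?_ <;>
        · funext j
          refine Fin.lastCases ?_ (fun j => ?_) j <;> simp
    rw [e]
    linarith

/-- Rokhlin's estimate for the entropy of a join. -/
lemma ent_fin_le {Y : ℕ → X → ι} {Z : ℕ → X → κ} (hY : ∀ j, Measurable (Y j))
    (hZ : ∀ j, Measurable (Z j)) (k : ℕ) :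
    ent μ (fun x (j : Fin k) => Y j x) ≤
      ent μ (fun x (j : Fin k) => Z j x) + ∑ j ∈ range k, condEnt μ (Y j) (Z j) :=
  (ent_le_ent_add_condEnt μ (measurable_pi_lambda (fun x (j : Fin k) => Y j x) fun j => hY j)
    (measurable_pi_lambda (fun x (j : Fin k) => Z j x) fun j => hZ j)).trans
    (by gcongr; exact condEnt_fin_le μ hY hZ k)

lemma ent_fin_le_sum {Y : ℕ → X → ι} (hY : ∀ j, Measurable (Y j)) (k : ℕ) :
    ent μ (fun x (j : Fin k) => Y j x) ≤ ∑ j ∈ range k, ent μ (Y j) := by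
  have h := ent_fin_le μ (Z := fun _ _ => ()) hY (fun _ => measurable_const) k
  have e2 : ∀ j, condEnt μ (Y j) (fun _ => ()) = ent μ (Y j) := by
    intro j
    rw [condEnt, ent_of_subsingleton μ (fun _ : X => ()), sub_zero]
    exact ent_congr_of_comp μ ((hY j).prodMk measurable_const) (hY j) Prod.fst (fun i => (i, ()))
      (fun _ => rfl) fun _ => rfl
  simpa [ent_of_subsingleton, e2] using h

lemma abs_real_sub_le (A B D : Set X) (h : ∀ x, x ∉ D → (x ∈ A ↔ x ∈ B)) :
    |μ.real A - μ.real B| ≤ μ.real D := by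
  have h1 : μ.real A ≤ μ.real B + μ.real D :=
    (measureReal_mono (by intro x hx; by_cases hd : x ∈ D <;> simp_all)).trans
      (measureReal_union_le B D)
  have h2 : μ.real B ≤ μ.real A + μ.real D :=
    (measureReal_mono (by intro x hx; by_cases hd : x ∈ D <;> simp_all)).trans
      (measureReal_union_le A D)
  rw [abs_le]; constructor <;> linarith

variable (ι) in
-- `H(Y | Z)` is the difference of the entropies of `(Y, Z)` and `(Z, Z)`. Their laws differ on each
-- cell by at most the measure of `{Y ≠ Z}`, and `negMulLog` is uniformly continuous on `[0, 1]`.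
lemma exists_condEnt_lt {ε : ℝ} (hε : 0 < ε) : ∃ δ > 0, ∀ Y Z : X → ι, Measurable Y →
    Measurable Z → μ.real {x | Y x ≠ Z x} < δ → condEnt μ Y Z < ε := by
  have huc := isCompact_Icc.uniformContinuousOn_of_continuous
    (continuous_negMulLog.continuousOn (s := Set.Icc (0 : ℝ) 1))
  rw [Metric.uniformContinuousOn_iff] at huc
  set c : ℝ := Fintype.card (ι × ι) + 1 with hc
  have hc0 : 0 < c := by positivity
  obtain ⟨δ, hδ, H⟩ := huc (ε / c) (by positivity)
  refine ⟨δ, hδ, fun Y Z hY hZ hYZ => ?_⟩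
  have e : ent μ Z = ent μ (fun x => (Z x, Z x)) :=
    ent_congr_of_comp μ hZ (hZ.prodMk hZ) (fun i => (i, i)) Prod.fst (fun _ => rfl) fun _ => rfl
  rw [condEnt, e, ent, ent, ← sum_sub_distrib]
  have hle : ∀ p : ι × ι, negMulLog (μ.real ((fun x => (Y x, Z x)) ⁻¹' {p})) -
      negMulLog (μ.real ((fun x => (Z x, Z x)) ⁻¹' {p})) ≤ ε / c := by
    intro p
    refine (le_abs_self _).trans ?_
    rw [← Real.dist_eq]
    refine (H _ ⟨measureReal_nonneg, measureReal_le_one⟩ _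
      ⟨measureReal_nonneg, measureReal_le_one⟩ ?_).le
    rw [Real.dist_eq]
    refine (abs_real_sub_le μ _ _ {x | Y x ≠ Z x} fun x hx => ?_).trans_lt hYZ
    simp only [Set.mem_ofPred_eq, not_not] at hx
    simp [hx]
  calc _ ≤ ∑ p : ι × ι, ε / c := sum_le_sum fun p _ => hle p
    _ = (c - 1) * (ε / c) := by simp [hc]
    _ < c * (ε / c) := by
        have : 0 < ε / c := by positivity
        nlinarith
    _ = ε := by field_simp

end Entropy

/-! ### Cesàro averages and a shift-invariant mean on bounded functions. -/

section Averages

open Finset Topology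

variable {F : Type*} [NormedAddCommGroup F] [NormedSpace ℝ F]

/-- Cesàro averages over `0 ≤ m < N` of a function on `ℤ`. -/
def avg (a : ℤ → F) (N : ℕ) : F := (N : ℝ)⁻¹ • ∑ m ∈ range N, a m

lemma avg_add (a a' : ℤ → F) (N : ℕ) : avg (fun m => a m + a' m) N = avg a N + avg a' N := by
  simp [avg, sum_add_distrib]

lemma avg_sub (a a' : ℤ → F) (N : ℕ) : avg (fun m => a m - a' m) N = avg a N - avg a' N := by
  simp [avg, sum_sub_distrib, smul_sub]

lemma avg_mono {a a' : ℤ → ℝ} (h : ∀ m, a m ≤ a' m) (N : ℕ) : avg a N ≤ avg a' N := by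
  simp only [avg, smul_eq_mul]
  gcongr with m
  exact h m

lemma avg_nonneg {a : ℤ → ℝ} (h : ∀ m, 0 ≤ a m) (N : ℕ) : 0 ≤ avg a N :=
  mul_nonneg (by positivity) (sum_nonneg fun m _ => h m)

lemma norm_avg_le_avg {a : ℤ → F} {ρ : ℤ → ℝ} (h : ∀ m, ‖a m‖ ≤ ρ m) (N : ℕ) :
    ‖avg a N‖ ≤ avg ρ N := by
  rw [avg, norm_smul, Real.norm_of_nonneg (by positivity)]
  simp only [avg, smul_eq_mul]
  gcongr
  exact norm_sum_le_of_le _ fun m _ => h m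

lemma avg_const_le {C : ℝ} (hC : 0 ≤ C) (N : ℕ) : avg (fun _ => C) N ≤ C := by
  rcases N.eq_zero_or_pos with rfl | h
  · simpa [avg] using hC
  · simp only [avg, sum_const, card_range, nsmul_eq_mul, smul_eq_mul]
    rw [inv_mul_cancel_left₀ (by positivity)]

lemma norm_avg_le {a : ℤ → F} {C : ℝ} (h : ∀ m, ‖a m‖ ≤ C) (N : ℕ) : ‖avg a N‖ ≤ C :=
  (norm_avg_le_avg h N).trans (avg_const_le ((norm_nonneg _).trans (h 0)) N)

/-- The difference telescopes to the boundary term `(a N - a 0) / N`. -/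
lemma tendsto_avg_shift_one {a : ℤ → F} {C : ℝ} (h : ∀ m, ‖a m‖ ≤ C) :
    Tendsto (fun N => avg (fun m => a (m + 1)) N - avg a N) atTop (𝓝 0) := by
  refine squeeze_zero_norm (a := fun N : ℕ => 2 * C / (N : ℝ)) (fun N => ?_)
    (tendsto_const_div_atTop_nhds_zero_nat _)
  have : avg (fun m => a (m + 1)) N - avg a N = (N : ℝ)⁻¹ • (a N - a 0) := by
    rw [avg, avg, ← smul_sub, ← sum_sub_distrib]
    have := sum_range_sub (fun n : ℕ => a n) N
    push_cast at this
    rw [this]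
  rw [this, norm_smul, Real.norm_of_nonneg (by positivity), inv_mul_eq_div]
  gcongr
  exact (norm_sub_le _ _).trans (by linarith [h N, h 0])

lemma tendsto_avg_shift {a : ℤ → F} {C : ℝ} (h : ∀ m, ‖a m‖ ≤ C) (k : ℤ) :
    Tendsto (fun N => avg (fun m => a (m + k)) N - avg a N) atTop (𝓝 0) := by
  induction k using Int.induction_on with
  | zero => simp
  | succ k ih =>
    have := (tendsto_avg_shift_one (a := fun m => a (m + k)) fun m => h _).add ih
    simpa [add_assoc, add_comm, add_left_comm] using this
  | pred k ih =>
    have := ih.sub (tendsto_avg_shift_one (a := fun m => a (m + (-k - 1))) fun m => h _)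
    simp only [sub_zero] at this
    refine this.congr fun N => ?_
    have e : ∀ m : ℤ, m + 1 + (-(k : ℤ) - 1) = m + -k := fun m => by ring
    simp only [e]
    abel

/-- A shift-invariant mean on the bounded functions on `ℤ`. -/
def mean (a : ℤ → ℂ) : ℂ := limUnder (hyperfilter ℕ : Filter ℕ) (avg a)

/-- The averages stay in a compact ball, so their image under an ultrafilter converges. -/
lemma tendsto_mean {a : ℤ → ℂ} {C : ℝ} (h : ∀ m, ‖a m‖ ≤ C) :
    Tendsto (avg a) (hyperfilter ℕ) (𝓝 (mean a)) := by
  apply tendsto_nhds_limUnder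
  have hK := isCompact_closedBall (0 : ℂ) C
  obtain ⟨z, -, hz⟩ := hK.ultrafilter_le_nhds ((hyperfilter ℕ).map (avg a))
    (le_principal_iff.2 (mem_map.2 (univ_mem' fun N => by
      simpa using norm_avg_le h N)))
  exact ⟨z, hz⟩

lemma mean_add {a a' : ℤ → ℂ} {C C' : ℝ} (h : ∀ m, ‖a m‖ ≤ C) (h' : ∀ m, ‖a' m‖ ≤ C') :
    mean (fun m => a m + a' m) = mean a + mean a' := by
  refine Tendsto.limUnder_eq (((tendsto_mean h).add (tendsto_mean h')).congr fun N => ?_)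
  rw [avg_add]

lemma mean_sub {a a' : ℤ → ℂ} {C C' : ℝ} (h : ∀ m, ‖a m‖ ≤ C) (h' : ∀ m, ‖a' m‖ ≤ C') :
    mean (fun m => a m - a' m) = mean a - mean a' := by
  refine Tendsto.limUnder_eq (((tendsto_mean h).sub (tendsto_mean h')).congr fun N => ?_)
  rw [avg_sub]

lemma mean_const_mul {a : ℤ → ℂ} {C : ℝ} (h : ∀ m, ‖a m‖ ≤ C) (c : ℂ) :
    mean (fun m => c * a m) = c * mean a := by
  refine Tendsto.limUnder_eq (((tendsto_mean h).const_mul c).congr fun N => ?_)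
  simp only [avg, mul_sum, Finset.smul_sum, Complex.real_smul]
  exact sum_congr rfl fun m _ => by ring

lemma norm_mean_le_of_le {a ρ : ℤ → ℂ} {C : ℝ} (hρ : ∀ m, ‖ρ m‖ ≤ C) (h : ∀ m, ‖a m‖ ≤ (ρ m).re) :
    ‖mean a‖ ≤ (mean ρ).re := by
  refine le_of_tendsto_of_tendsto'
    (tendsto_mean fun m => (h m).trans ((Complex.re_le_norm _).trans (hρ m))).norm
    ((Complex.continuous_re.tendsto _).comp (tendsto_mean hρ)) fun N => ?_
  refine (norm_avg_le_avg h N).trans_eq ?_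
  simp [avg]

lemma norm_mean_le {a : ℤ → ℂ} {C : ℝ} (h : ∀ m, ‖a m‖ ≤ C) : ‖mean a‖ ≤ C :=
  le_of_tendsto' (tendsto_mean h).norm fun N => norm_avg_le h N

lemma mean_shift {a : ℤ → ℂ} {C : ℝ} (h : ∀ m, ‖a m‖ ≤ C) (k : ℤ) :
    mean (fun m => a (m + k)) = mean a := by
  refine Tendsto.limUnder_eq ?_
  have := ((tendsto_avg_shift h k).mono_left Nat.hyperfilter_le_atTop).add (tendsto_mean h)
  simpa using this

end Averages

/-! ### Strips with tent weights on their columns. -/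

section Strip

/-- A tent function supported on `[0, r]`. -/
def tent (r s : ℝ) : ℝ := max 0 (min s (r - s))

lemma tent_nonneg (r s : ℝ) : 0 ≤ tent r s := le_max_left _ _

lemma tent_le_self (r : ℝ) {s : ℝ} (hs : 0 ≤ s) : tent r s ≤ s := max_le hs (min_le_left _ _)

lemma tent_le_one_sub {r s : ℝ} (hr : r ≤ 1) (hs : s ≤ 1) : tent r s ≤ 1 - s :=
  max_le (by linarith) ((min_le_right _ _).trans (by linarith))

lemma lt_of_tent_pos {r s : ℝ} (h : 0 < tent r s) : 0 < s ∧ s < r := by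
  rcases lt_max_iff.mp h with h | h
  · exact absurd h (lt_irrefl _)
  · rw [lt_min_iff] at h; exact ⟨h.1, by linarith⟩

lemma abs_tent_sub_le (r s s' : ℝ) : |tent r s - tent r s'| ≤ |s - s'| := by
  refine (abs_max_sub_max_le_max _ _ _ _).trans (max_le (by simp) ?_)
  refine (abs_min_sub_min_le_max _ _ _ _).trans (max_le le_rfl ?_)
  rw [show r - s - (r - s') = -(s - s') by ring, abs_neg]

/-- The weight of the `m`-th column of the strip. -/
def weight (r β w : ℝ) (m : ℤ) : ℝ := tent r (Int.fract (β * m - w))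

/-- The lattice point of the `m`-th column just below the line `y = β x - w`. -/
def latticePoint (β w : ℝ) (m : ℤ) : ℤ × ℤ := (m, ⌊β * m - w⌋)

lemma weight_nonneg (r β w : ℝ) (m : ℤ) : 0 ≤ weight r β w m := tent_nonneg _ _

lemma weight_le_one (r β w : ℝ) (m : ℤ) : weight r β w m ≤ 1 :=
  (tent_le_self r (Int.fract_nonneg _)).trans (Int.fract_lt_one _).le

/-- The offset `-(r / 2)` centres the window: fractional part in `(0, r)` means that the lattice
point is less than `r / 2` away vertically from `y = β x`. -/
lemma latticePoint_mem_strip {r b β : ℝ} (hrb : r ≤ b) {m : ℤ}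
    (h : 0 < weight r β (-(r / 2)) m) : latticePoint β (-(r / 2)) m ∈ strip β b := by
  obtain ⟨h1, h2⟩ := lt_of_tent_pos h
  have := Int.self_sub_floor (β * m - -(r / 2))
  simp only [strip, latticePoint, Set.mem_ofPred_eq]
  constructor <;> linarith

/-- The mean of a function over a smoothed strip. -/
def stripMean (r β w : ℝ) (φ : ℤ × ℤ → ℂ) : ℂ :=
  mean fun m => (weight r β w m : ℂ) * φ (latticePoint β w m)

variable {r β w : ℝ} {φ φ' : ℤ × ℤ → ℂ} {C C' : ℝ}

lemma norm_weight_mul_le {m : ℤ} {z : ℂ} (h : ‖z‖ ≤ C) : ‖(weight r β w m : ℂ) * z‖ ≤ C := by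
  rw [norm_mul, Complex.norm_real, Real.norm_of_nonneg (weight_nonneg _ _ _ _)]
  exact (mul_le_of_le_one_left (norm_nonneg _) (weight_le_one _ _ _ _)).trans h

lemma stripMean_add (h : ∀ g, ‖φ g‖ ≤ C) (h' : ∀ g, ‖φ' g‖ ≤ C') :
    stripMean r β w (fun g => φ g + φ' g) = stripMean r β w φ + stripMean r β w φ' := by
  simp only [stripMean, mul_add]
  exact mean_add (fun m => norm_weight_mul_le (h _)) (fun m => norm_weight_mul_le (h' _))

lemma stripMean_const_mul (h : ∀ g, ‖φ g‖ ≤ C) (c : ℂ) :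
    stripMean r β w (fun g => c * φ g) = c * stripMean r β w φ := by
  simp only [stripMean, mul_left_comm _ c]
  exact mean_const_mul (fun m => norm_weight_mul_le (h _)) c

lemma norm_stripMean_le (h : ∀ g, ‖φ g‖ ≤ C) : ‖stripMean r β w φ‖ ≤ C :=
  norm_mean_le fun _ => norm_weight_mul_le (h _)

lemma norm_stripMean_le_of_le {ρ : ℤ × ℤ → ℂ} (hρ : ∀ g, ‖ρ g‖ ≤ C) (h : ∀ g, ‖φ g‖ ≤ (ρ g).re) :
    ‖stripMean r β w φ‖ ≤ (stripMean r β w ρ).re := by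
  refine norm_mean_le_of_le (fun _ => norm_weight_mul_le (hρ _)) fun m => ?_
  rw [norm_mul, Complex.norm_real, Real.norm_of_nonneg (weight_nonneg _ _ _ _),
    Complex.re_ofReal_mul]
  exact mul_le_mul_of_nonneg_left (h _) (weight_nonneg _ _ _ _)

/-- Translating a strip by a lattice vector only changes its offset: the first coordinate is
absorbed by shift invariance of the mean, the second by the floor. -/
lemma stripMean_shift (h : ∀ g, ‖φ g‖ ≤ C) (g₀ : ℤ × ℤ) :
    stripMean r β w (fun g => φ (g - g₀)) = stripMean r β (w + g₀.2 - β * g₀.1) φ := by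
  have := mean_shift (a := fun m => (weight r β (w + g₀.2 - β * g₀.1) m : ℂ) *
    φ (latticePoint β (w + g₀.2 - β * g₀.1) m)) (fun m => norm_weight_mul_le (h _)) (-g₀.1)
  rw [stripMean, stripMean, ← this]
  congr 1
  funext m
  have e : β * ((m + -g₀.1 : ℤ) : ℝ) - (w + g₀.2 - β * g₀.1) = β * m - w - (g₀.2 : ℤ) := by
    push_cast; ring
  simp only [weight, latticePoint, e, Int.fract_sub_intCast, Int.floor_sub_intCast]
  rfl

/-- In each column, either both offsets select the same lattice point and the tent is 1-Lipschitz,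
or the floor jumps in between. In the latter case both weights are at most `|w - w'|`, because the
tent vanishes at both ends of `[0, 1]`; this gives the factor 2. -/
lemma norm_stripMean_sub_le (hr : r ≤ 1) (h : ∀ g, ‖φ g‖ ≤ C) (w w' : ℝ) :
    ‖stripMean r β w φ - stripMean r β w' φ‖ ≤ 2 * |w - w'| * C := by
  wlog hw : w' ≤ w generalizing w w'
  · rw [norm_sub_rev, abs_sub_comm]
    exact this w' w (le_of_not_ge hw)
  rw [stripMean, stripMean, ← mean_sub (fun m => norm_weight_mul_le (h _))
    (fun m => norm_weight_mul_le (h _))]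
  refine norm_mean_le fun m => ?_
  have hC : 0 ≤ C := (norm_nonneg _).trans (h 0)
  rw [abs_of_nonneg (by linarith)]
  set u := β * m - w with hu
  set u' := β * m - w' with hu'
  have huu : u' - u = w - w' := by rw [hu, hu']; ring
  by_cases hf : ⌊u⌋ = ⌊u'⌋
  · have : latticePoint β w m = latticePoint β w' m := by simp [latticePoint, ← hu, ← hu', hf]
    rw [this, ← sub_mul, norm_mul, ← Complex.ofReal_sub, Complex.norm_real]
    refine mul_le_mul ?_ (h _) (norm_nonneg _) (by linarith)
    refine (abs_tent_sub_le _ _ _).trans ?_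
    rw [← hu, ← hu', Int.fract, Int.fract, hf, show u - ⌊u'⌋ - (u' - ⌊u'⌋) = -(u' - u) by ring,
      huu, abs_neg, abs_of_nonneg (by linarith)]
    linarith
  · have hlt : ⌊u⌋ < ⌊u'⌋ := lt_of_le_of_ne (Int.floor_le_floor (by linarith)) hf
    have hlt' : (⌊u⌋ : ℝ) + 1 ≤ ⌊u'⌋ := by exact_mod_cast hlt
    have h1 : weight r β w m ≤ w - w' := by
      refine (tent_le_one_sub hr (Int.fract_lt_one _).le).trans ?_
      rw [← hu, Int.fract]
      linarith [Int.floor_le u']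
    have h2 : weight r β w' m ≤ w - w' := by
      refine (tent_le_self r (Int.fract_nonneg _)).trans ?_
      rw [← hu', Int.fract]
      linarith [Int.lt_floor_add_one u]
    refine (norm_sub_le _ _).trans ?_
    simp only [norm_mul, Complex.norm_real, Real.norm_of_nonneg (weight_nonneg _ _ _ _)]
    have a1 := mul_le_mul h1 (h (latticePoint β w m)) (norm_nonneg _) (by linarith)
    have a2 := mul_le_mul h2 (h (latticePoint β w' m)) (norm_nonneg _) (by linarith)
    linarith

/-- A strip is covered by finitely many translates of any narrower strip. -/
lemma exists_finset_strip_cover (β b₀ : ℝ) {b : ℝ} (hb : 0 < b) :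
    ∃ F : Finset (ℤ × ℤ), ∀ g ∈ strip β b₀, ∃ g₀ ∈ F, g - g₀ ∈ strip β b := by
  set ℓ : ℤ × ℤ → ℝ := fun g => g.2 - β * g.1 with hℓ
  have hT : TotallyBounded (ℓ '' strip β b₀) := by
    refine (totallyBounded_Icc (-(b₀ / 2)) (b₀ / 2)).subset ?_
    rintro _ ⟨g, ⟨h1, h2⟩, rfl⟩
    constructor <;> simp only [hℓ] <;> linarith
  -- The vertical offset `ℓ` is additive and bounded on the strip, so translates by points realising
  -- a `b / 2`-net of offsets suffice.
  obtain ⟨t, ht, htf, hcov⟩ := Metric.finite_approx_of_totallyBounded hT (b / 2) (by positivity)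
  classical
  obtain ⟨F, -, hF⟩ := Finset.subset_set_image_iff.mp
    (show (htf.toFinset : Set ℝ) ⊆ ℓ '' strip β b₀ by simpa using ht)
  refine ⟨F, fun g hg => ?_⟩
  obtain ⟨y, hy, hgy⟩ := Set.mem_iUnion₂.mp (hcov ⟨g, hg, rfl⟩)
  rw [← htf.mem_toFinset, ← hF, Finset.mem_image] at hy
  obtain ⟨g₀, hg₀, rfl⟩ := hy
  refine ⟨g₀, hg₀, ?_⟩
  rw [Metric.mem_ball, Real.dist_eq, abs_lt] at hgy
  simp only [hℓ] at hgy
  simp only [strip, Set.mem_ofPred_eq, Prod.fst_sub, Prod.snd_sub]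
  push_cast
  constructor <;> linarith [hgy.1, hgy.2]

/-- The columns of positive weight have positive density. -/
lemma not_tendsto_avg_weight (β : ℝ) {r : ℝ} (hr : 0 < r) (hr1 : r ≤ 1) :
    ¬ Tendsto (avg (weight r β (-(r / 2)))) (hyperfilter ℕ) (nhds 0) := by
  intro hlim
  -- The strip of width 1 meets every column, and on the centred strip of width `r / 2` the tent is
  -- at least `r / 4`. Finitely many shifts of the weight thus sum to at least `r / 4` everywhere,
  -- which shift invariance of the averages forbids if the density is zero.
  obtain ⟨F, hF⟩ := exists_finset_strip_cover β 1 (b := r / 2) (by positivity)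
  have hcol : ∀ m : ℤ, r / 4 ≤ ∑ g ∈ F, weight r β (-(r / 2)) (m + -g.1) := by
    intro m
    have hm : (m, round (β * m)) ∈ strip β 1 := by
      have := abs_le.mp (abs_sub_round (β * m))
      simp only [strip, Set.mem_ofPred_eq]
      constructor <;> linarith
    obtain ⟨g, hg, h1, h2⟩ := hF _ hm
    simp only [Prod.fst_sub, Prod.snd_sub] at h1 h2
    refine le_trans ?_ (Finset.single_le_sum (fun g _ => weight_nonneg _ _ _ _) hg)
    set n := round (β * m) - g.2
    have hfr : Int.fract (β * (m + -g.1 : ℤ) - -(r / 2)) = β * (m + -g.1 : ℤ) - -(r / 2) - n := by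
      rw [Int.fract_eq_iff]
      refine ⟨?_, ?_, n, by ring⟩ <;> rw [← sub_eq_add_neg] <;> linarith
    rw [weight, hfr, tent]
    refine le_max_of_le_right (le_min ?_ ?_) <;> rw [← sub_eq_add_neg] <;> linarith
  have hb : ∀ m, ‖weight r β (-(r / 2)) m‖ ≤ 1 := fun m => by
    rw [Real.norm_of_nonneg (weight_nonneg _ _ _ _)]; exact weight_le_one _ _ _ _
  have hlim2 : ∀ k : ℤ, Tendsto (avg fun m => weight r β (-(r / 2)) (m + k)) (hyperfilter ℕ)
      (nhds 0) := fun k => by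
    simpa using ((tendsto_avg_shift hb k).mono_left Nat.hyperfilter_le_atTop).add hlim
  have hlim3 := tendsto_finsetSum F fun g _ => hlim2 (-g.1)
  simp only [Finset.sum_const_zero] at hlim3
  have : r / 4 ≤ 0 := by
    refine ge_of_tendsto hlim3 (Nat.hyperfilter_le_atTop ?_)
    filter_upwards [eventually_gt_atTop 0] with N hN
    have h1 : avg (fun _ => r / 4) N = r / 4 := by
      simp only [avg, Finset.sum_const, Finset.card_range, nsmul_eq_mul, smul_eq_mul]
      rw [inv_mul_cancel_left₀ (by positivity)]
    rw [← h1]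
    refine (avg_mono hcol N).trans_eq ?_
    simp only [avg, ← Finset.smul_sum]
    rw [Finset.sum_comm]
  linarith

end Strip

/-! ### Compact averaged operators and decay of correlations. -/

section Hilbert

open scoped InnerProductSpace

set_option linter.unusedSectionVars false

variable {E : Type*} [NormedAddCommGroup E] [InnerProductSpace ℂ E] [CompleteSpace E]

/-- The matrix coefficients of the rank one operators `f ⊗ f*` along an action. -/
def coeff (U : ℤ × ℤ → E →ₗᵢ[ℂ] E) (f x y : E) (g : ℤ × ℤ) : ℂ := ⟪x, U g f⟫_ℂ * ⟪U g f, y⟫_ℂ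

lemma norm_coeff_le (U : ℤ × ℤ → E →ₗᵢ[ℂ] E) (f x y : E) (g : ℤ × ℤ) :
    ‖coeff U f x y g‖ ≤ ‖f‖ ^ 2 * ‖x‖ * ‖y‖ := by
  rw [coeff, norm_mul]
  have h1 := norm_inner_le_norm (𝕜 := ℂ) x (U g f)
  have h2 := norm_inner_le_norm (𝕜 := ℂ) (U g f) y
  rw [(U g).norm_map] at h1 h2
  calc _ ≤ (‖x‖ * ‖f‖) * (‖f‖ * ‖y‖) := by gcongr
    _ = _ := by ring

lemma coeff_self (U : ℤ × ℤ → E →ₗᵢ[ℂ] E) (f x : E) (g : ℤ × ℤ) :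
    coeff U f x x g = ((‖⟪x, U g f⟫_ℂ‖ ^ 2 : ℝ) : ℂ) := by
  rw [coeff, ← inner_conj_symm (U g f) x, Complex.mul_conj, Complex.normSq_eq_norm_sq]

/-- The sesquilinear form averaging `⟪x, U g f⟫ ⟪U g f, y⟫` over a smoothed strip. -/
def stripForm (r β w : ℝ) (U : ℤ × ℤ → E →ₗᵢ[ℂ] E) (f : E) : E →L⋆[ℂ] E →L[ℂ] ℂ :=
  LinearMap.mkContinuous₂
    (LinearMap.mk₂'ₛₗ (starRingEnd ℂ) (RingHom.id ℂ)
      (fun x y => stripMean r β w (coeff U f x y))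
      (fun x x' y => by
        rw [← stripMean_add (norm_coeff_le U f x y) (norm_coeff_le U f x' y)]
        congr 1; funext g
        simp [coeff, add_mul])
      (fun c x y => by
        rw [smul_eq_mul, ← stripMean_const_mul (norm_coeff_le U f x y)]
        congr 1; funext g
        simp only [coeff, inner_smul_left]; ring)
      (fun x y y' => by
        rw [← stripMean_add (norm_coeff_le U f x y) (norm_coeff_le U f x y')]
        congr 1; funext g
        simp [coeff, mul_add])
      (fun c x y => by
        rw [RingHom.id_apply, smul_eq_mul, ← stripMean_const_mul (norm_coeff_le U f x y)]
        congr 1; funext g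
        simp only [coeff, inner_smul_right]; ring))
    (‖f‖ ^ 2) (fun x y => norm_stripMean_le (norm_coeff_le U f x y))

/-- The weak average of the operators `x ↦ ⟪U g f, x⟫ U g f` over a smoothed strip. -/
def stripOp (r β w : ℝ) (U : ℤ × ℤ → E →ₗᵢ[ℂ] E) (f : E) : E →L[ℂ] E :=
  InnerProductSpace.continuousLinearMapOfBilin (stripForm r β w U f)

variable (r β w : ℝ) (U : ℤ × ℤ → E →ₗᵢ[ℂ] E) (f : E)

lemma inner_stripOp (x y : E) :
    ⟪stripOp r β w U f x, y⟫_ℂ = stripMean r β w (coeff U f x y) := by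
  rw [stripOp, InnerProductSpace.continuousLinearMapOfBilin_apply]
  rfl

/-- The quadratic form of `stripOp`. -/
def stripQuad (x : E) : ℝ := (stripMean r β w (coeff U f x x)).re

lemma stripQuad_smul (c : ℝ) (x : E) :
    stripQuad r β w U f ((c : ℂ) • x) = c ^ 2 * stripQuad r β w U f x := by
  have : coeff U f ((c : ℂ) • x) ((c : ℂ) • x) = fun g => ((c ^ 2 : ℝ) : ℂ) * coeff U f x x g := by
    funext g
    simp only [coeff, inner_smul_left, inner_smul_right, Complex.conj_ofReal]
    push_cast; ring
  rw [stripQuad, this, stripMean_const_mul (norm_coeff_le U f x x), Complex.re_ofReal_mul,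
    stripQuad]

/-- A form of `‖A x‖² ≤ ‖A‖ ⟪A x, x⟫` for positive `A`. The arithmetic-geometric mean inequality is
applied to the coefficients before averaging, with `y = A x`; the resulting `‖y‖² / 2` is absorbed
on the left. -/
lemma norm_stripOp_sq_le (x : E) :
    ‖stripOp r β w U f x‖ ^ 2 ≤ (‖f‖ ^ 2 + 1) * stripQuad r β w U f x := by
  set y := stripOp r β w U f x with hy
  set t := ‖f‖ ^ 2 + 1 with ht
  have ht0 : 0 < t := by positivity
  set D : ℝ := ‖y‖ ^ 2 / 2 with hD
  have hρ : ∀ g, ‖(fun g => ((t / 2 : ℝ) : ℂ) * coeff U f x x g + (fun _ => (D : ℂ)) g) g‖ ≤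
      t / 2 * (‖f‖ ^ 2 * ‖x‖ * ‖x‖) + D := by
    intro g
    refine (norm_add_le _ _).trans (add_le_add ?_ ?_)
    · rw [norm_mul, Complex.norm_real, Real.norm_of_nonneg (by positivity)]
      gcongr
      exact norm_coeff_le U f x x g
    · rw [Complex.norm_real, Real.norm_of_nonneg (by positivity)]
  have h1 : ‖stripMean r β w (coeff U f x y)‖ ≤ _ := norm_stripMean_le_of_le hρ (fun g => by
    rw [coeff_self, coeff, norm_mul, Complex.add_re, Complex.re_ofReal_mul, Complex.ofReal_re,
      Complex.ofReal_re]
    have h2 : ‖⟪U g f, y⟫_ℂ‖ ≤ ‖f‖ * ‖y‖ := by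
      have := norm_inner_le_norm (𝕜 := ℂ) (U g f) y
      rwa [(U g).norm_map] at this
    set p := ‖⟪x, U g f⟫_ℂ‖
    have h3 : p * ‖⟪U g f, y⟫_ℂ‖ ≤ p * (‖f‖ * ‖y‖) := by gcongr
    have h4 : 2 * (p * ‖f‖) * ‖y‖ ≤ (p * ‖f‖) ^ 2 + ‖y‖ ^ 2 := two_mul_le_add_sq _ _
    have h5 : (p * ‖f‖) ^ 2 ≤ t * p ^ 2 := by rw [ht]; nlinarith [sq_nonneg p]
    rw [hD]
    linarith)
  have hb1 : ∀ g, ‖((t / 2 : ℝ) : ℂ) * coeff U f x x g‖ ≤ t / 2 * (‖f‖ ^ 2 * ‖x‖ * ‖x‖) := by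
    intro g
    rw [norm_mul, Complex.norm_real, Real.norm_of_nonneg (by positivity)]
    gcongr
    exact norm_coeff_le U f x x g
  have hb2 : ∀ g : ℤ × ℤ, ‖(fun _ => (D : ℂ)) g‖ ≤ D := fun g => by
    rw [Complex.norm_real, Real.norm_of_nonneg (by positivity)]
  rw [stripMean_add hb1 hb2, stripMean_const_mul (norm_coeff_le U f x x), Complex.add_re,
    Complex.re_ofReal_mul, ← inner_stripOp, ← hy, inner_self_eq_norm_sq_to_K] at h1
  have h6 := (Complex.re_le_norm _).trans (norm_stripMean_le (r := r) (β := β) (w := w) hb2)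
  have h7 : ‖((‖y‖ : ℂ)) ^ 2‖ = ‖y‖ ^ 2 := by simp
  change _ ≤ t / 2 * stripQuad r β w U f x + _ at h1
  have h8 : ‖y‖ ^ 2 ≤ t / 2 * stripQuad r β w U f x + D := by
    rw [← h7]; exact h1.trans (by gcongr)
  rw [hD] at h8
  linarith

/-- Bessel's inequality for each `U g f`, then averaging: the trace is at most `‖f‖²`. -/
lemma sum_stripQuad_le {n : ℕ} {e : Fin n → E} (he : Orthonormal ℂ e) :
    ∑ i, stripQuad r β w U f (e i) ≤ ‖f‖ ^ 2 := by
  have hsum : ∀ s : Finset (Fin n), stripMean r β w (fun g => ∑ i ∈ s, coeff U f (e i) (e i) g) =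
      ∑ i ∈ s, stripMean r β w (coeff U f (e i) (e i)) := by
    classical
    intro s
    induction s using Finset.induction_on with
    | empty =>
      have := norm_stripMean_le (r := r) (β := β) (w := w) (φ := fun _ => 0) (C := 0) (by simp)
      simpa using this
    | insert i s hi ih =>
      simp only [Finset.sum_insert hi]
      rw [← ih]
      exact stripMean_add (norm_coeff_le U f _ _)
        (fun g => norm_sum_le_of_le s fun j _ => norm_coeff_le U f (e j) (e j) g)
  have hle : ‖stripMean r β w (fun g => ∑ i, coeff U f (e i) (e i) g)‖ ≤ ‖f‖ ^ 2 := by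
    refine norm_stripMean_le fun g => ?_
    simp_rw [coeff_self]
    rw [← Complex.ofReal_sum, Complex.norm_real, Real.norm_of_nonneg (by positivity)]
    have := he.sum_inner_products_le (s := Finset.univ) (U g f)
    rwa [(U g).norm_map] at this
  rw [hsum] at hle
  have := (Complex.re_le_norm _).trans hle
  rwa [Complex.re_sum] at this

/-- A positive form of finite trace is small off a finite-dimensional subspace. -/
lemma exists_finite_orthonormal {ε : ℝ} (hε : 0 < ε) : ∃ (n : ℕ) (e : Fin n → E), Orthonormal ℂ e ∧
    ∀ x, (∀ i, ⟪e i, x⟫_ℂ = 0) → stripQuad r β w U f x ≤ ε * ‖x‖ ^ 2 := by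
  set T : Set ℝ := {t | ∃ (n : ℕ) (e : Fin n → E), Orthonormal ℂ e ∧
    ∑ i, stripQuad r β w U f (e i) = t}
  have hT : BddAbove T := ⟨‖f‖ ^ 2, by rintro _ ⟨n, e, he, rfl⟩; exact sum_stripQuad_le r β w U f he⟩
  have hT0 : T.Nonempty := ⟨_, 0, Fin.elim0, ⟨fun i => i.elim0, fun i => i.elim0⟩, rfl⟩
  -- The family `e` has trace within `ε` of the supremum. A unit vector orthogonal to it can be
  -- adjoined, so its quadratic form is at most `ε`.
  obtain ⟨_, ⟨n, e, he, rfl⟩, hlt⟩ := exists_lt_of_lt_csSup hT0 (sub_lt_self (sSup T) hε)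
  refine ⟨n, e, he, fun x hx => ?_⟩
  rcases eq_or_ne x 0 with rfl | hx0
  · have := stripQuad_smul r β w U f 0 0
    simp at this
    simp [this]
  set u : E := ((‖x‖⁻¹ : ℝ) : ℂ) • x with hu
  have hun : ‖u‖ = 1 := by
    rw [hu, norm_smul, Complex.norm_real, norm_inv, norm_norm, inv_mul_cancel₀ (by simpa)]
  have hxu : x = ((‖x‖ : ℝ) : ℂ) • u := by
    rw [hu, smul_smul, ← Complex.ofReal_mul, mul_inv_cancel₀ (by simpa)]; simp
  have heu : ∀ i, ⟪e i, u⟫_ℂ = 0 := fun i => by rw [hu, inner_smul_right, hx, mul_zero]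
  have hue : ∀ i, ⟪u, e i⟫_ℂ = 0 := fun i => by rw [← inner_conj_symm, heu, map_zero]
  have hon : Orthonormal ℂ (Fin.cons u e : Fin (n + 1) → E) := by
    constructor
    · intro i
      refine Fin.cases ?_ (fun i => ?_) i
      · simpa using hun
      · simpa using he.1 i
    · intro i j
      refine Fin.cases ?_ (fun i => ?_) i <;> refine Fin.cases ?_ (fun j => ?_) j
      · simp
      · simpa using fun _ => hue j
      · simpa using heu i
      · intro hij
        simpa using he.2 (fun h => hij (by rw [h]))
  have hle := le_csSup hT ⟨n + 1, _, hon, rfl⟩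
  rw [Fin.sum_univ_succ] at hle
  simp only [Fin.cons_zero, Fin.cons_succ] at hle
  rw [hxu, stripQuad_smul, ← hxu, mul_comm]
  gcongr
  linarith

/-- Compactness of the operator: it is small in norm on the complement of a finite-dimensional span,
and maps balls of that span to compact sets. -/
lemma exists_finite_net_stripOp (R : ℝ) {ε : ℝ} (hε : 0 < ε) :
    ∃ t : Set E, t.Finite ∧ ∀ x, ‖x‖ ≤ R → ∃ y ∈ t, ‖stripOp r β w U f x - y‖ < ε := by
  set c := (‖f‖ ^ 2 + 1) * ((2 * R) ^ 2 + 1) with hc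
  have hc0 : 0 < c := by positivity
  obtain ⟨n, e, he, hq⟩ := exists_finite_orthonormal r β w U f (ε := (ε / 2) ^ 2 / c) (by positivity)
  set V := Submodule.span ℂ (Set.range e)
  have : FiniteDimensional ℂ V := FiniteDimensional.span_of_finite ℂ (Set.finite_range e)
  have hcpt : IsCompact ((fun v : V => stripOp r β w U f v) '' Metric.closedBall 0 R) :=
    (isCompact_closedBall (0 : V) R).image (by fun_prop)
  obtain ⟨t, -, htf, ht⟩ := Metric.finite_approx_of_totallyBounded hcpt.totallyBounded (ε / 2)
    (by positivity)
  refine ⟨t, htf, fun x hx => ?_⟩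
  set p : V := V.orthogonalProjectionOnto x with hp
  have hpn : ‖p‖ ≤ R := (V.norm_orthogonalProjectionOnto_apply_le x).trans hx
  obtain ⟨y, hy, hpy⟩ := Set.mem_iUnion₂.mp (ht ⟨p, by simpa using hpn, rfl⟩)
  refine ⟨y, hy, ?_⟩
  rw [Metric.mem_ball, dist_eq_norm] at hpy
  have hperp : ∀ i, ⟪e i, x - p⟫_ℂ = 0 := fun i =>
    (V.sub_starProjection_mem_orthogonal x) _ (Submodule.subset_span ⟨i, rfl⟩)
  have hxp : ‖x - p‖ ≤ 2 * R :=
    (norm_sub_le _ _).trans (by rw [Submodule.norm_coe]; linarith)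
  have h1 := norm_stripOp_sq_le r β w U f (x - p)
  have h2 := hq _ hperp
  have h3 : ‖stripOp r β w U f (x - p)‖ ^ 2 ≤ (ε / 2) ^ 2 := by
    calc _ ≤ (‖f‖ ^ 2 + 1) * ((ε / 2) ^ 2 / c * ‖x - p‖ ^ 2) := h1.trans (by gcongr)
      _ ≤ (‖f‖ ^ 2 + 1) * ((ε / 2) ^ 2 / c * ((2 * R) ^ 2 + 1)) := by
        gcongr
        have : ‖x - p‖ ^ 2 ≤ (2 * R) ^ 2 := by gcongr
        linarith
      _ = _ := by rw [hc]; field_simp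
  have h4 : ‖stripOp r β w U f (x - p)‖ ≤ ε / 2 := le_of_sq_le_sq h3 (by positivity)
  calc ‖stripOp r β w U f x - y‖
      = ‖stripOp r β w U f (x - p) + (stripOp r β w U f p - y)‖ := by rw [map_sub]; congr 1; abel
    _ ≤ _ := norm_add_le _ _
    _ < ε := by linarith

variable {r}

/-- Pairing the difference with itself turns the Lipschitz bound for means into a norm bound. -/
lemma norm_stripOp_sub_le (hr : r ≤ 1) (w w' : ℝ) (x : E) :
    ‖stripOp r β w U f x - stripOp r β w' U f x‖ ≤ 2 * |w - w'| * (‖f‖ ^ 2 * ‖x‖) := by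
  set z := stripOp r β w U f x - stripOp r β w' U f x with hz
  have h := norm_stripMean_sub_le (β := β) hr (norm_coeff_le U f x z) w w'
  rw [← inner_stripOp, ← inner_stripOp, ← inner_sub_left, ← hz, inner_self_eq_norm_sq_to_K] at h
  have h7 : ‖((‖z‖ : ℂ)) ^ 2‖ = ‖z‖ * ‖z‖ := by simp [sq]
  have h' : ‖z‖ * ‖z‖ ≤ (2 * |w - w'| * (‖f‖ ^ 2 * ‖x‖)) * ‖z‖ := by
    rw [← h7]; refine h.trans_eq (by ring)
  rcases (norm_nonneg z).eq_or_lt with h0 | h0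
  · rw [← h0]; positivity
  · exact le_of_mul_le_mul_right h' h0

variable {U} (hU0 : ∀ x, U 0 x = x) (hU : ∀ g g' x, U (g + g') x = U g (U g' x))

include hU0 hU in
-- Conjugating the averaged rank one operators by `U g₀` translates the index by `g₀`, hence changes
-- the offset.
lemma U_stripOp (g₀ : ℤ × ℤ) (x : E) :
    U g₀ (stripOp r β (w + g₀.2 - β * g₀.1) U f x) = stripOp r β w U f (U g₀ x) := by
  have hinv : ∀ g x, U g (U (-g) x) = x := fun g x => by rw [← hU, add_neg_cancel, hU0]
  refine ext_inner_right ℂ fun z => ?_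
  rw [← hinv g₀ z, (U g₀).inner_map_map, inner_stripOp, inner_stripOp,
    ← stripMean_shift (norm_coeff_le U f _ _)]
  congr 1
  funext g
  have : U g f = U g₀ (U (g - g₀) f) := by rw [← hU]; congr 2; abel
  rw [coeff, coeff, this, (U g₀).inner_map_map, (U g₀).inner_map_map]

include hU0 hU in
/-- Vectors in the range of `stripOp` have precompact orbits along every strip. -/
lemma totallyBounded_orbit_stripOp (hr : r ≤ 1) (b : ℝ) (x : E) :
    TotallyBounded ((fun g => U g (stripOp r β w U f x)) '' strip β b) := by
  rw [Metric.totallyBounded_iff]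
  intro ε hε
  set c := 2 * (‖f‖ ^ 2 * ‖x‖) + 1 with hc
  have hc0 : 0 < c := by positivity
  -- Moving `U g` past the operator leaves an offset in this interval, applied to a vector of norm
  -- `‖x‖`. A finite net of offsets, with a finite net for each of their operators, covers the
  -- orbit.
  obtain ⟨W, -, hWf, hW⟩ := Metric.finite_approx_of_totallyBounded
    (totallyBounded_Icc (w - b / 2) (w + b / 2)) (ε / 2 / c) (by positivity)
  choose t htf ht using fun w' =>
    exists_finite_net_stripOp r β w' U f ‖x‖ (half_pos hε)
  refine ⟨⋃ w' ∈ W, t w', hWf.biUnion fun w' _ => htf w', ?_⟩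
  rintro _ ⟨g, ⟨hg1, hg2⟩, rfl⟩
  set w₁ := w - g.2 + β * g.1 with hw₁
  have hmem : w₁ ∈ Set.Icc (w - b / 2) (w + b / 2) := by constructor <;> linarith
  obtain ⟨w', hw', hd⟩ := Set.mem_iUnion₂.mp (hW hmem)
  rw [Metric.mem_ball, Real.dist_eq] at hd
  obtain ⟨y, hy, hxy⟩ := ht w' (U g x) (by rw [(U g).norm_map])
  refine Set.mem_iUnion₂.mpr ⟨y, Set.mem_iUnion₂.mpr ⟨w', hw', hy⟩, ?_⟩
  have e := U_stripOp (r := r) β w₁ f hU0 hU g x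
  rw [show w₁ + g.2 - β * g.1 = w by rw [hw₁]; ring] at e
  simp only
  rw [e, Metric.mem_ball, dist_eq_norm]
  have h1 := norm_stripOp_sub_le β U f hr w₁ w' (U g x)
  rw [(U g).norm_map] at h1
  have h2 : 2 * |w₁ - w'| * (‖f‖ ^ 2 * ‖x‖) ≤ ε / 2 := by
    calc _ = |w₁ - w'| * (2 * (‖f‖ ^ 2 * ‖x‖)) := by ring
      _ ≤ (ε / 2 / c) * c := by gcongr; rw [hc]; linarith
      _ = ε / 2 := by field_simp
  calc _ = ‖(stripOp r β w₁ U f (U g x) - stripOp r β w' U f (U g x)) +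
        (stripOp r β w' U f (U g x) - y)‖ := by congr 1; abel
    _ ≤ _ := norm_add_le _ _
    _ < ε := by linarith

include hU0 hU in
/-- If `h` is orthogonal to all vectors with precompact orbit along a strip, its correlations tend
to zero on average along every strip. -/
theorem tendsto_avg_correlation (hr : r ≤ 1) (b : ℝ) (h : E)
    (hAP : ∀ x, TotallyBounded ((fun g => U g x) '' strip β b) → ⟪x, h⟫_ℂ = 0) :
    Tendsto (avg fun m => weight r β w m * ‖⟪h, U (latticePoint β w m) f⟫_ℂ‖ ^ 2)
      (hyperfilter ℕ) (nhds 0) := by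
  -- Applied to the image of `h` itself: the vanishing inner product is the mean of the squared
  -- correlations.
  have h0 := hAP _ (totallyBounded_orbit_stripOp β w f hU0 hU hr b h)
  rw [inner_stripOp] at h0
  have hlim := tendsto_mean (a := fun m => (weight r β w m : ℂ) * coeff U f h h (latticePoint β w m))
    (fun m => norm_weight_mul_le (norm_coeff_le U f h h _))
  rw [show mean _ = 0 from h0] at hlim
  have hre := (Complex.continuous_re.tendsto _).comp hlim
  rw [Complex.zero_re] at hre
  refine hre.congr fun N => ?_
  simp only [Function.comp, avg, coeff_self, ← Complex.ofReal_mul, ← Complex.ofReal_sum,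
    Complex.real_smul, Complex.ofReal_re, smul_eq_mul]

end Hilbert

/-! ### Convergence off sets of weighted density zero. -/

section DensityFilter

open Topology

lemma avg_zero : avg (fun _ => (0 : ℝ)) = fun _ => 0 := by
  funext N
  simp [avg]

lemma tendsto_avg_zero_of_le {l : Filter ℕ} {a a' : ℤ → ℝ} (h0 : ∀ m, 0 ≤ a m)
    (h : ∀ m, a m ≤ a' m) (ha' : Tendsto (avg a') l (𝓝 0)) : Tendsto (avg a) l (𝓝 0) :=
  squeeze_zero (avg_nonneg h0) (avg_mono h) ha'

/-- The filter of the sets of integers whose complement has mean zero with respect to a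
nonnegative weight. -/
def densityFilter (ω : ℤ → ℝ) (hω : ∀ m, 0 ≤ ω m) : Filter ℤ where
  sets := {A | Tendsto (avg fun m => ω m * Aᶜ.indicator 1 m) (hyperfilter ℕ) (𝓝 0)}
  univ_sets := by simp [avg_zero]
  sets_of_superset {A B} hA hAB := by
    refine tendsto_avg_zero_of_le (fun m => ?_) (fun m => ?_) hA
    · exact mul_nonneg (hω m) (Set.indicator_nonneg (fun _ _ => zero_le_one) m)
    · refine mul_le_mul_of_nonneg_left ?_ (hω m)
      exact Set.indicator_le_indicator_of_subset (Set.compl_subset_compl.mpr hAB)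
        (fun _ => zero_le_one) m
  inter_sets {A B} hA hB := by
    have h := Tendsto.add hA hB
    rw [add_zero] at h
    refine tendsto_avg_zero_of_le (fun m => ?_) (fun m => ?_) (h.congr fun N => (avg_add _ _ N).symm)
    · exact mul_nonneg (hω m) (Set.indicator_nonneg (fun _ _ => zero_le_one) m)
    · rw [← mul_add]
      refine mul_le_mul_of_nonneg_left ?_ (hω m)
      by_cases h1 : m ∈ A <;> by_cases h2 : m ∈ B <;> simp [Set.indicator, h1, h2]

variable {ω : ℤ → ℝ} {hω : ∀ m, 0 ≤ ω m}

lemma mem_densityFilter {A : Set ℤ} : A ∈ densityFilter ω hω ↔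
    Tendsto (avg fun m => ω m * Aᶜ.indicator 1 m) (hyperfilter ℕ) (𝓝 0) := Iff.rfl

lemma densityFilter_neBot (h : ¬ Tendsto (avg ω) (hyperfilter ℕ) (𝓝 0)) :
    (densityFilter ω hω).NeBot := by
  refine ⟨fun hbot => h ?_⟩
  have : ∅ ∈ densityFilter ω hω := by rw [hbot]; exact mem_bot
  simpa [mem_densityFilter] using this

lemma eventually_pos_densityFilter : ∀ᶠ m in densityFilter ω hω, 0 < ω m := by
  refine mem_densityFilter.mpr ?_
  have : ∀ m, ω m * {m | 0 < ω m}ᶜ.indicator 1 m = 0 := by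
    intro m
    rcases (hω m).eq_or_lt with h | h
    · rw [← h, zero_mul]
    · simp [Set.indicator, h]
  simp [this, avg_zero]

/-- The averages over `0 ≤ m < N` see at most `M.toNat + 1` columns with `m ≤ M`, each of weight at
most `C`. -/
lemma eventually_gt_densityFilter {C : ℝ} (hC : ∀ m, ω m ≤ C) (M : ℤ) :
    ∀ᶠ m in densityFilter ω hω, M < m := by
  refine mem_densityFilter.mpr ?_
  refine Tendsto.mono_left ?_ Nat.hyperfilter_le_atTop
  refine squeeze_zero (fun N => avg_nonneg (fun m => mul_nonneg (hω m)
    (Set.indicator_nonneg (fun _ _ => zero_le_one) m)) N) (fun N => ?_)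
    (tendsto_const_div_atTop_nhds_zero_nat (C * (M.toNat + 1 : ℕ)))
  have hC0 : 0 ≤ C := (hω 0).trans (hC 0)
  rw [avg, smul_eq_mul, inv_mul_eq_div]
  gcongr
  calc ∑ m ∈ Finset.range N, ω m * {m | M < m}ᶜ.indicator 1 (m : ℤ)
      ≤ ∑ m ∈ Finset.range N, if m ∈ Finset.range (M.toNat + 1) then C else 0 := by
        refine Finset.sum_le_sum fun m _ => ?_
        by_cases hm : M < (m : ℤ)
        · simp only [Set.indicator, Set.mem_compl_iff, Set.mem_ofPred_eq, hm, not_true_eq_false,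
            if_false, mul_zero]
          split_ifs <;> simp [hC0]
        · have : m ∈ Finset.range (M.toNat + 1) := by simp; omega
          simpa [Set.indicator, hm, this] using hC m
    _ ≤ ∑ m ∈ Finset.range (M.toNat + 1), C := by
        rw [← Finset.sum_filter]
        refine Finset.sum_le_sum_of_subset_of_nonneg ?_ fun _ _ _ => hC0
        intro m hm
        exact (Finset.mem_filter.mp hm).2
    _ = _ := by simp; ring

/-- Chebyshev's inequality: the indicator of `{‖a‖ ≥ ε}` is at most `‖a‖² / ε²`. -/
lemma tendsto_densityFilter {a : ℤ → ℂ}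
    (h : Tendsto (avg fun m => ω m * ‖a m‖ ^ 2) (hyperfilter ℕ) (𝓝 0)) :
    Tendsto a (densityFilter ω hω) (𝓝 0) := by
  rw [Metric.tendsto_nhds]
  intro ε hε
  refine mem_densityFilter.mpr ?_
  have h2 := h.const_mul (1 / ε ^ 2)
  rw [mul_zero] at h2
  refine tendsto_avg_zero_of_le (a' := fun m => 1 / ε ^ 2 * (ω m * ‖a m‖ ^ 2)) (fun m => ?_)
    (fun m => ?_) (h2.congr fun N => ?_)
  · exact mul_nonneg (hω m) (Set.indicator_nonneg (fun _ _ => zero_le_one) m)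
  · by_cases hm : dist (a m) 0 < ε
    · simp only [Set.indicator, Set.mem_compl_iff, Set.mem_ofPred_eq, hm, not_true_eq_false,
        if_false, mul_zero]
      have := hω m
      positivity
    · have hm' := hm
      rw [dist_zero_right, not_lt] at hm'
      simp only [Set.indicator, Set.mem_compl_iff, Set.mem_ofPred_eq, hm, not_false_eq_true,
        if_true, Pi.one_apply]
      rw [mul_left_comm]
      refine mul_le_mul_of_nonneg_left ?_ (hω m)
      rw [one_div, inv_mul_eq_div, one_le_div (by positivity)]
      gcongr
  · simp only [avg, Finset.mul_sum, smul_eq_mul]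
    exact Finset.sum_congr rfl fun m _ => by ring

end DensityFilter

/-! ### The Kronecker algebra and mixing along a filter. -/

section Koopman

open scoped InnerProductSpace
open Topology

set_option linter.unusedSectionVars false

variable {X : Type*} [MeasurableSpace X]

lemma real_norm_ge_mul_sq_le (μ : Measure X) [IsFiniteMeasure μ] {F : Type*} [NormedAddCommGroup F]
    (f : Lp F 2 μ) {δ : ℝ} (hδ : 0 < δ) : δ ^ 2 * μ.real {x | δ ≤ ‖f x‖} ≤ ‖f‖ ^ 2 := by
  have h := Lp.mul_meas_ge_le_pow_enorm' f two_ne_zero ENNReal.ofNat_ne_top (ENNReal.ofReal δ)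
  have e : {x | ENNReal.ofReal δ ≤ ‖f x‖ₑ} = {x | δ ≤ ‖f x‖} := by
    ext x
    simp only [Set.mem_ofPred_eq]
    rw [← ofReal_norm, ENNReal.ofReal_le_ofReal_iff (norm_nonneg _)]
  have h' : ENNReal.ofReal δ ^ (2 : ENNReal).toReal * μ {x | ENNReal.ofReal δ ≤ ‖f x‖ₑ} ≤
    ENNReal.ofReal ‖f‖ ^ (2 : ENNReal).toReal := h
  rw [e] at h'
  have h2 := ENNReal.toReal_mono (by finiteness) h'
  simpa [ENNReal.toReal_ofReal hδ.le, ← ENNReal.toReal_rpow, measureReal_def] using h2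

lemma exists_finset_net {ι Y : Type*} [PseudoMetricSpace Y] {V : ι → Y} {s : Set ι}
    (h : TotallyBounded (V '' s)) {ε : ℝ} (hε : 0 < ε) :
    ∃ G : Finset ι, (G : Set ι) ⊆ s ∧ ∀ g ∈ s, ∃ g' ∈ G, dist (V g) (V g') < ε := by
  classical
  obtain ⟨T, hTs, hTf, hT⟩ := Metric.finite_approx_of_totallyBounded h ε hε
  obtain ⟨G, hGs, hG⟩ := Finset.subset_set_image_iff.mp
    (show (hTf.toFinset : Set Y) ⊆ V '' s by simpa using hTs)
  refine ⟨G, hGs, fun g hg => ?_⟩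
  obtain ⟨y, hy, hgy⟩ := Set.mem_iUnion₂.mp (hT ⟨g, hg, rfl⟩)
  rw [← hTf.mem_toFinset, ← hG, Finset.mem_image] at hy
  obtain ⟨g', hg', rfl⟩ := hy
  exact ⟨g', hg', hgy⟩

variable [AddAction (ℤ × ℤ) X] [MeasurableConstVAdd (ℤ × ℤ) X]
  (μ : Measure X) [IsProbabilityMeasure μ] [VAddInvariantMeasure (ℤ × ℤ) X μ]

lemma koopman_coeFn (g : ℤ × ℤ) (f : Lp ℂ 2 μ) : koopman μ g f =ᵐ[μ] fun x => f (g +ᵥ x) :=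
  Lp.coeFn_compMeasurePreserving f (measurePreserving_vadd g μ)

lemma koopman_zero (f : Lp ℂ 2 μ) : koopman μ 0 f = f := by
  refine Lp.ext ((koopman_coeFn μ 0 f).trans ?_)
  simp only [zero_vadd]
  rfl

lemma koopman_add (g g' : ℤ × ℤ) (f : Lp ℂ 2 μ) :
    koopman μ (g + g') f = koopman μ g (koopman μ g' f) := by
  refine Lp.ext ((koopman_coeFn μ _ f).trans ?_)
  refine EventuallyEq.trans ?_ (koopman_coeFn μ g (koopman μ g' f)).symm
  have := (measurePreserving_vadd g μ).quasiMeasurePreserving.ae_eq (koopman_coeFn μ g' f)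
  refine EventuallyEq.trans ?_ this.symm
  refine EventuallyEq.of_eq ?_
  funext x
  simp only [Function.comp, ← add_vadd, add_comm g g']

/-- The indicator function of a set in `L²`. -/
def ind {B : Set X} (hB : MeasurableSet B) : Lp ℂ 2 μ :=
  indicatorConstLp 2 hB (measure_ne_top μ B) 1

lemma measurableSet_vadd_preimage {B : Set X} (hB : MeasurableSet B) (g : ℤ × ℤ) :
    MeasurableSet ((fun x => g +ᵥ x) ⁻¹' B) := measurable_const_vadd g hB

lemma koopman_ind {B : Set X} (hB : MeasurableSet B) (g : ℤ × ℤ) :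
    koopman μ g (ind μ hB) = ind μ (measurableSet_vadd_preimage hB g) := rfl

lemma inner_ind {A B : Set X} (hA : MeasurableSet A) (hB : MeasurableSet B) :
    ⟪ind μ hA, ind μ hB⟫_ℂ = μ.real (A ∩ B) :=
  L2.inner_indicatorConstLp_one_indicatorConstLp_one hA hB

lemma dist_ind_sq {A B : Set X} (hA : MeasurableSet A) (hB : MeasurableSet B) :
    dist (ind μ hA) (ind μ hB) ^ 2 = μ.real (symmDiff A B) := by
  rw [ind, ind, dist_indicatorConstLp_eq_norm, norm_indicatorConstLp two_ne_zero ENNReal.ofNat_ne_top]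
  simp only [norm_one, one_mul, ENNReal.toReal_ofNat]
  rw [← Real.rpow_natCast, ← Real.rpow_mul measureReal_nonneg]
  norm_num

lemma mem_kroneckerAlgebra_iff {β b : ℝ} {B : Set X} : B ∈ kroneckerAlgebra μ β b ↔
    ∃ hB : MeasurableSet B, TotallyBounded ((fun g => koopman μ g (ind μ hB)) '' strip β b) := by
  refine exists_congr fun hB => ⟨fun h => h.totallyBounded.subset subset_closure, fun h => ?_⟩
  exact h.closure.isCompact_of_isClosed isClosed_closure

/-- The orbit along one strip lies in finitely many isometric images of the orbit along another.
This decouples `b₀` from `b`. -/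
lemma totallyBounded_orbit_of_strip {β b : ℝ} (hb : 0 < b) (b' : ℝ) {f : Lp ℂ 2 μ}
    (h : TotallyBounded ((fun g => koopman μ g f) '' strip β b)) :
    TotallyBounded ((fun g => koopman μ g f) '' strip β b') := by
  obtain ⟨F, hF⟩ := exists_finset_strip_cover β b' hb
  have : TotallyBounded (⋃ g₀ ∈ (F : Set (ℤ × ℤ)),
      koopman μ g₀ '' ((fun g => koopman μ g f) '' strip β b)) :=
    (totallyBounded_biUnion F.finite_toSet).mpr fun g₀ _ =>
      h.image (koopman μ g₀).isometry.uniformContinuous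
  refine this.subset ?_
  rintro _ ⟨g, hg, rfl⟩
  obtain ⟨g₀, hg₀, hgg⟩ := hF g hg
  refine Set.mem_iUnion₂.mpr ⟨g₀, hg₀, _, ⟨_, hgg, rfl⟩, ?_⟩
  simp only
  rw [← koopman_add, add_sub_cancel]

/-- The slabs decrease to the empty set. Leaving out the level `t` itself makes this work at every
`t`, including atoms of the distribution. -/
lemma exists_real_Ioc_lt {u : X → ℝ} (hu : Measurable u) (t : ℝ) {ε : ℝ} (hε : 0 < ε) :
    ∃ δ > 0, μ.real {x | t < u x ∧ u x ≤ t + δ} < ε := by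
  set s : ℕ → Set X := fun n => {x | t < u x ∧ u x ≤ t + 1 / ((n : ℝ) + 1)} with hs
  have hm : ∀ n, MeasurableSet (s n) := fun n =>
    (measurableSet_lt measurable_const hu).inter (measurableSet_le hu measurable_const)
  have hanti : Antitone s := fun n m hnm x hx => ⟨hx.1, hx.2.trans (by
    have := Nat.one_div_le_one_div (α := ℝ) hnm
    linarith)⟩
  have hlim := tendsto_measure_iInter_atTop (μ := μ) (fun n => (hm n).nullMeasurableSet) hanti
    ⟨0, measure_ne_top μ _⟩
  have hempty : ⋂ n, s n = ∅ := by
    refine Set.eq_empty_of_forall_notMem fun x hx => ?_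
    rw [Set.mem_iInter] at hx
    obtain ⟨n, hn⟩ := exists_nat_one_div_lt (sub_pos.mpr (hx 0).1)
    linarith [(hx n).2]
  rw [hempty, measure_empty] at hlim
  have hlim2 := (ENNReal.tendsto_toReal ENNReal.zero_ne_top).comp hlim
  obtain ⟨n, hn⟩ := (hlim2.eventually (gt_mem_nhds hε)).exists
  exact ⟨1 / ((n : ℝ) + 1), by positivity, hn⟩

/-- Superlevel sets of functions with precompact orbit have precompact orbit. -/
lemma superlevel_mem_kroneckerAlgebra {β b : ℝ} {f : Lp ℂ 2 μ}
    (hf : TotallyBounded ((fun g => koopman μ g f) '' strip β b)) {π : ℂ → ℝ}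
    (hπ : ∀ z z', |π z - π z'| ≤ ‖z - z'‖) (t : ℝ) :
    {x | t < π (f x)} ∈ kroneckerAlgebra μ β b := by
  have hπc : Continuous π := by
    refine (LipschitzWith.of_dist_le_mul (K := 1) fun z z' => ?_).continuous
    simpa [Real.dist_eq, dist_eq_norm] using hπ z z'
  have hu : Measurable fun x => π (f x) := hπc.measurable.comp (Lp.stronglyMeasurable f).measurable
  have hB : MeasurableSet {x | t < π (f x)} := measurableSet_lt measurable_const hu
  refine (mem_kroneckerAlgebra_iff μ).mpr ⟨hB, ?_⟩
  rw [Metric.totallyBounded_iff]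
  intro ε hε
  obtain ⟨δ, hδ, hδε⟩ := exists_real_Ioc_lt μ hu t (ε := ε ^ 2 / 4) (by positivity)
  -- With this radius, Chebyshev at height `δ` leaves an exceptional set of measure below `ε ^ 2 /
  -- 4`.
  obtain ⟨G, -, hG⟩ := exists_finset_net hf (ε := δ * ε / 2) (by positivity)
  refine ⟨(fun g => koopman μ g (ind μ hB)) '' G, G.finite_toSet.image _, ?_⟩
  rintro _ ⟨g, hg, rfl⟩
  obtain ⟨g', hg', hd⟩ := hG g hg
  refine Set.mem_iUnion₂.mpr ⟨_, ⟨g', hg', rfl⟩, ?_⟩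
  simp only [Metric.mem_ball, koopman_ind]
  refine lt_of_pow_lt_pow_left₀ 2 hε.le ?_
  rw [dist_ind_sq]
  have hE : ∀ k : ℤ × ℤ, μ.real {x | t < π (f (k +ᵥ x)) ∧ π (f (k +ᵥ x)) ≤ t + δ} < ε ^ 2 / 4 := by
    intro k
    have hm : MeasurableSet {x | t < π (f x) ∧ π (f x) ≤ t + δ} :=
      (measurableSet_lt measurable_const hu).inter (measurableSet_le hu measurable_const)
    rw [← (measurePreserving_vadd k μ).measureReal_preimage hm.nullMeasurableSet] at hδε
    exact hδε
  have hD : μ.real {x | δ ≤ ‖f (g +ᵥ x) - f (g' +ᵥ x)‖} < ε ^ 2 / 4 := by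
    have h1 := real_norm_ge_mul_sq_le μ (koopman μ g f - koopman μ g' f) hδ
    have h2 : μ.real {x | δ ≤ ‖(koopman μ g f - koopman μ g' f : Lp ℂ 2 μ) x‖} =
        μ.real {x | δ ≤ ‖f (g +ᵥ x) - f (g' +ᵥ x)‖} := by
      refine measureReal_congr ?_
      filter_upwards [Lp.coeFn_sub (koopman μ g f) (koopman μ g' f), koopman_coeFn μ g f,
        koopman_coeFn μ g' f] with x h1 h2 h3
      refine propext ?_
      change δ ≤ _ ↔ δ ≤ _
      rw [h1, Pi.sub_apply, h2, h3]
    rw [h2, ← dist_eq_norm] at h1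
    have h3 : dist (koopman μ g f) (koopman μ g' f) ^ 2 < (δ * ε / 2) ^ 2 := by gcongr
    have h4 : δ ^ 2 * μ.real {x | δ ≤ ‖f (g +ᵥ x) - f (g' +ᵥ x)‖} < δ ^ 2 * (ε ^ 2 / 4) :=
      h1.trans_lt (h3.trans_eq (by ring))
    exact lt_of_mul_lt_mul_left h4 (by positivity)
  -- Where exactly one translate exceeds `t`, that one lies in the slab `(t, t + δ]` or the two
  -- translates of `f` differ by at least `δ`.
  calc _ ≤ μ.real (({x | t < π (f (g +ᵥ x)) ∧ π (f (g +ᵥ x)) ≤ t + δ} ∪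
        {x | t < π (f (g' +ᵥ x)) ∧ π (f (g' +ᵥ x)) ≤ t + δ}) ∪
        {x | δ ≤ ‖f (g +ᵥ x) - f (g' +ᵥ x)‖}) := by
        refine measureReal_mono fun x hx => ?_
        by_contra hcon
        simp only [Set.mem_union, Set.mem_ofPred_eq, not_or, not_and, not_le] at hcon
        obtain ⟨⟨h1, h2⟩, h3⟩ := hcon
        have h4 := abs_le.mp ((hπ (f (g +ᵥ x)) (f (g' +ᵥ x))).trans h3.le)
        rcases hx with ⟨h5, h6⟩ | ⟨h5, h6⟩
        · simp only [Set.mem_preimage, Set.mem_ofPred_eq, not_lt] at h5 h6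
          linarith [h1 h5, h4.2]
        · simp only [Set.mem_preimage, Set.mem_ofPred_eq, not_lt] at h5 h6
          linarith [h2 h5, h4.1]
    _ ≤ _ := (measureReal_union_le _ _).trans (add_le_add_left (measureReal_union_le _ _) _)
    _ < ε ^ 2 := by linarith [hE g, hE g', sq_nonneg ε]

/-- Countably many half-lines with rational endpoints separate the points of `ℝ`. -/
lemma exists_ae_eq_const_of_superlevel {u : X → ℝ}
    (h : ∀ t, {x | t < u x} =ᵐ[μ] (∅ : Set X) ∨ {x | t < u x} =ᵐ[μ] (Set.univ : Set X)) :
    ∃ c, u =ᵐ[μ] fun _ => c := by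
  have : HasCountableSeparatingOn ℝ (fun U => ∃ t, U = Set.Ioi t) Set.univ := by
    refine ⟨Set.range fun q : ℚ => Set.Ioi (q : ℝ), Set.countable_range _, ?_, fun x _ y _ hxy => ?_⟩
    · rintro _ ⟨q, rfl⟩
      exact ⟨q, rfl⟩
    · by_contra hne
      rcases lt_or_gt_of_ne hne with hlt | hlt <;> obtain ⟨q, hq1, hq2⟩ := exists_rat_btwn hlt
      · exact absurd ((hxy _ ⟨q, rfl⟩).mpr hq2) (not_lt.mpr hq1.le)
      · exact absurd ((hxy _ ⟨q, rfl⟩).mp hq2) (not_lt.mpr hq1.le)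
  refine exists_eventuallyEq_const_of_forall_separating (fun U => ∃ t, U = Set.Ioi t) ?_
  rintro _ ⟨t, rfl⟩
  refine (h t).symm.imp (fun h => ?_) fun h => ?_
  · filter_upwards [h.mem_iff] with x hx
    exact hx.mpr trivial
  · filter_upwards [h.mem_iff] with x hx
    exact fun hlt => hx.mp hlt

/-- In a weakly mixing system, vectors with precompact orbit are constant. -/
lemma exists_ae_eq_const_of_totallyBounded {β b : ℝ} (hwm : IsWeakMixing μ β b) {f : Lp ℂ 2 μ}
    (hf : TotallyBounded ((fun g => koopman μ g f) '' strip β b)) :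
    ∃ c : ℂ, f =ᵐ[μ] fun _ => c := by
  have h : ∀ π : ℂ → ℝ, (∀ z z', |π z - π z'| ≤ ‖z - z'‖) →
      ∃ c, (fun x => π (f x)) =ᵐ[μ] fun _ => c := fun π hπ =>
    exists_ae_eq_const_of_superlevel μ fun t =>
      hwm _ (superlevel_mem_kroneckerAlgebra μ hf hπ t)
  obtain ⟨c, hc⟩ := h Complex.re fun z z' => by
    rw [← Complex.sub_re]; exact Complex.abs_re_le_norm _
  obtain ⟨d, hd⟩ := h Complex.im fun z z' => by
    rw [← Complex.sub_im]; exact Complex.abs_im_le_norm _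
  refine ⟨⟨c, d⟩, ?_⟩
  filter_upwards [hc, hd] with x h1 h2
  exact Complex.ext h1 h2

lemma inner_ind_sub_eq_zero {f : Lp ℂ 2 μ} {c : ℂ} (hf : f =ᵐ[μ] fun _ => c) {C : Set X}
    (hC : MeasurableSet C) :
    ⟪f, ind μ hC - (μ.real C : ℂ) • ind μ MeasurableSet.univ⟫_ℂ = 0 := by
  have : f = c • ind μ MeasurableSet.univ := by
    refine Lp.ext ?_
    filter_upwards [hf, Lp.coeFn_smul c (ind μ (MeasurableSet.univ : MeasurableSet (Set.univ : Set X))),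
      indicatorConstLp_coeFn (p := 2) (hs := MeasurableSet.univ) (hμs := measure_ne_top μ _)
        (c := (1 : ℂ))] with x h1 h2 h3
    rw [h1, h2, Pi.smul_apply, ind, h3]
    simp
  rw [this, inner_smul_left, inner_sub_right, inner_smul_right, inner_ind, inner_ind]
  simp

/-- In a weakly mixing system, there is a filter of lattice points inside any strip, escaping to
infinity, along which the action is mixing. -/
theorem exists_mixing_filter {β b₀ b : ℝ} (hb : 0 < b) (hwm : IsWeakMixing μ β b₀) :
    ∃ 𝓕 : Filter (ℤ × ℤ), 𝓕.NeBot ∧ (∀ᶠ g in 𝓕, g ∈ strip β b) ∧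
      (∀ M : ℤ, ∀ᶠ g in 𝓕, M < g.1) ∧ ∀ A C : Set X, MeasurableSet A → MeasurableSet C →
        Tendsto (fun g : ℤ × ℤ => μ.real (C ∩ (fun x => g +ᵥ x) ⁻¹' A)) 𝓕
          (𝓝 (μ.real C * μ.real A)) := by
  -- The bound `r ≤ b` keeps the points in the strip; `r ≤ 1` is needed for the Lipschitz estimate
  -- on the weights.
  set r := min b 1 with hr
  have hr0 : 0 < r := lt_min hb one_pos
  have hr1 : r ≤ 1 := min_le_right _ _
  set w := -(r / 2) with hw
  set 𝓓 := densityFilter (weight r β w) (weight_nonneg r β w)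
  have hne : 𝓓.NeBot := densityFilter_neBot (not_tendsto_avg_weight β hr0 hr1)
  refine ⟨𝓓.map (latticePoint β w), hne.map _, ?_, fun M => ?_, fun A C hA hC => ?_⟩
  · exact eventually_map.mpr (eventually_pos_densityFilter.mono fun m hm =>
      latticePoint_mem_strip (min_le_left _ _) hm)
  · exact eventually_map.mpr (eventually_gt_densityFilter (weight_le_one r β w) M)
  · rw [tendsto_map'_iff]
    have h1 := tendsto_densityFilter (hω := weight_nonneg r β w) (tendsto_avg_correlation β w (ind μ hA)
      (koopman_zero μ) (koopman_add μ) hr1 b₀ (ind μ hC - (μ.real C : ℂ) • ind μ MeasurableSet.univ) fun f hf => by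
        obtain ⟨c, hc⟩ := exists_ae_eq_const_of_totallyBounded μ hwm hf
        exact inner_ind_sub_eq_zero μ hc hC)
    have h2 : ∀ g, ⟪ind μ hC - (μ.real C : ℂ) • ind μ MeasurableSet.univ,
        koopman μ g (ind μ hA)⟫_ℂ =
        ((μ.real (C ∩ (fun x => g +ᵥ x) ⁻¹' A) - μ.real C * μ.real A : ℝ) : ℂ) := by
      intro g
      rw [koopman_ind, inner_sub_left, inner_smul_left, inner_ind, inner_ind, Set.univ_inter,
        (measurePreserving_vadd g μ).measureReal_preimage hA.nullMeasurableSet]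
      simp
    simp only [h2] at h1
    have h3 := (Complex.continuous_re.tendsto _).comp h1
    rw [Complex.zero_re] at h3
    have h4 := h3.add_const (μ.real C * μ.real A)
    simpa [Function.comp_def] using h4

end Koopman

/-! ### Partitions as finite-valued functions, separability, asymptotic independence. -/

section Labels

open Real Topology

set_option linter.unusedSectionVars false

variable {X ι κ : Type*} [MeasurableSpace X]

namespace MeasurablePartition

/-- The index of the cell containing a point. -/
def label (α : MeasurablePartition ι X) (x : X) : ι :=
  (Set.mem_iUnion.mp (α.iUnion_cell ▸ Set.mem_univ x : x ∈ ⋃ i, α.cell i)).choose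

lemma mem_cell_label (α : MeasurablePartition ι X) (x : X) : x ∈ α.cell (α.label x) :=
  (Set.mem_iUnion.mp (α.iUnion_cell ▸ Set.mem_univ x : x ∈ ⋃ i, α.cell i)).choose_spec

lemma label_eq_iff (α : MeasurablePartition ι X) {x : X} {i : ι} :
    α.label x = i ↔ x ∈ α.cell i := by
  refine ⟨fun h => h ▸ α.mem_cell_label x, fun h => ?_⟩
  by_contra hne
  exact Set.disjoint_left.mp (α.disjoint_cell _ _ hne) (α.mem_cell_label x) h

lemma label_preimage (α : MeasurablePartition ι X) (i : ι) : α.label ⁻¹' {i} = α.cell i := by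
  ext x
  exact α.label_eq_iff

lemma measurable_label [Countable ι] [MeasurableSpace ι] (α : MeasurablePartition ι X) :
    Measurable α.label :=
  measurable_to_countable' fun i => by
    rw [label_preimage]; exact α.measurableSet_cell i

lemma entropy_eq_ent [Fintype ι] (μ : Measure X) (α : MeasurablePartition ι X) :
    α.entropy μ = ent μ α.label := by
  simp only [entropy, ent, label_preimage]

end MeasurablePartition

variable [Fintype ι] [MeasurableSpace ι] [MeasurableSingletonClass ι]
  [Fintype κ] [MeasurableSpace κ] [MeasurableSingletonClass κ]
  (μ : Measure X) [IsProbabilityMeasure μ]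

lemma sum_real_preimage {Y : X → ι} (hY : Measurable Y) : ∑ i, μ.real (Y ⁻¹' {i}) = 1 := by
  have := real_preimage_comp μ hY (fun _ => ()) ()
  simpa [Set.preimage] using this.symm

/-- Finite-valued measurable functions form a separable space. -/
lemma exists_dense_labels [MeasurableSpace.CountablyGenerated X] (r : ℕ) :
    ∃ 𝒴 : ℕ → X → Fin (r + 1), (∀ n, Measurable (𝒴 n)) ∧
      ∀ Y : X → Fin (r + 1), Measurable Y → ∀ δ > 0, ∃ n, μ.real {x | 𝒴 n x ≠ Y x} < δ := by
  have : Fact ((2 : ENNReal) ≠ ⊤) := ⟨ENNReal.ofNat_ne_top⟩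
  -- Labels are encoded as integers in the separable space `L²`. Distinct labels differ by at least
  -- 1, so the measure of the disagreement set is at most the squared distance.
  let Λ : Set (Lp ℝ 2 μ) :=
    {y | ∃ Y : X → Fin (r + 1), Measurable Y ∧ y =ᵐ[μ] fun x => ((Y x : ℕ) : ℝ)}
  have hmem : ∀ Y : X → Fin (r + 1), Measurable Y → MemLp (fun x => ((Y x : ℕ) : ℝ)) 2 μ := by
    intro Y hY
    refine MemLp.of_bound ((measurable_of_finite (fun i : Fin (r + 1) => ((i : ℕ) : ℝ))).comp
      hY).aestronglyMeasurable (r + 1) (ae_of_all _ fun x => ?_)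
    rw [Real.norm_of_nonneg (by positivity)]
    exact_mod_cast (Y x).is_lt.le
  have hne : Nonempty Λ :=
    ⟨⟨(hmem (fun _ => 0) measurable_const).toLp, _, measurable_const, MemLp.coeFn_toLp _⟩⟩
  choose 𝒴 h𝒴 h𝒴' using fun n => (TopologicalSpace.denseSeq Λ n).2
  refine ⟨𝒴, h𝒴, fun Y hY δ hδ => ?_⟩
  obtain ⟨n, hn⟩ := (TopologicalSpace.denseRange_denseSeq Λ).exists_dist_lt
    ⟨(hmem Y hY).toLp, Y, hY, MemLp.coeFn_toLp _⟩ (sqrt_pos.mpr hδ)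
  refine ⟨n, ?_⟩
  set d : Lp ℝ 2 μ := (TopologicalSpace.denseSeq Λ n).1 - (hmem Y hY).toLp with hd
  have hdn : ‖d‖ < √δ := by
    rw [dist_comm] at hn
    rw [hd, ← dist_eq_norm]
    exact hn
  have h1 := real_norm_ge_mul_sq_le μ d one_pos
  rw [one_pow, one_mul] at h1
  refine lt_of_le_of_lt ?_ (h1.trans_lt ((pow_lt_pow_left₀ hdn (norm_nonneg _) two_ne_zero).trans_eq
    (sq_sqrt hδ.le)))
  refine ENNReal.toReal_mono (measure_ne_top _ _) (measure_mono_ae ?_)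
  filter_upwards [Lp.coeFn_sub (TopologicalSpace.denseSeq Λ n).1 (hmem Y hY).toLp, h𝒴' n,
    (hmem Y hY).coeFn_toLp] with x e1 e2 e3 hx
  change 1 ≤ ‖d x‖
  rw [hd, e1, Pi.sub_apply, e2, e3, Real.norm_eq_abs]
  have hne : ((𝒴 n x : ℕ) : ℤ) - (Y x : ℕ) ≠ 0 := by
    intro h
    apply hx
    apply Fin.ext
    omega
  exact_mod_cast Int.one_le_abs hne

variable [AddAction (ℤ × ℤ) X] [MeasurableConstVAdd (ℤ × ℤ) X]
  [VAddInvariantMeasure (ℤ × ℤ) X μ]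

lemma sequenceJoin_entropy (α : MeasurablePartition ι X) (S : ℕ → ℤ × ℤ) (k : ℕ) :
    (sequenceJoin α S k).entropy μ = ent μ (fun x (j : Fin k) => α.label (S j +ᵥ x)) := by
  refine Finset.sum_congr rfl fun v _ => ?_
  congr 2
  ext x
  simp only [sequenceJoin, MeasurablePartition.join, MeasurablePartition.comap, Set.mem_iInter,
    Set.mem_preimage, Set.mem_singleton_iff, funext_iff, MeasurablePartition.label_eq_iff]

lemma measurable_comp_vadd {Y : X → ι} (hY : Measurable Y) (g : ℤ × ℤ) :
    Measurable fun x => Y (g +ᵥ x) := hY.comp (measurable_const_vadd g)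

/-- Along a mixing filter, translates of `Y` become independent of `W`. -/
lemma tendsto_ent_of_mixing {𝓕 : Filter (ℤ × ℤ)}
    (h𝓕 : ∀ A C : Set X, MeasurableSet A → MeasurableSet C →
      Tendsto (fun g : ℤ × ℤ => μ.real (C ∩ (fun x => g +ᵥ x) ⁻¹' A)) 𝓕 (𝓝 (μ.real C * μ.real A)))
    {W : X → κ} {Y : X → ι} (hW : Measurable W) (hY : Measurable Y) :
    Tendsto (fun g : ℤ × ℤ => ent μ (fun x => (W x, Y (g +ᵥ x)))) 𝓕 (𝓝 (ent μ W + ent μ Y)) := by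
  have e : ent μ W + ent μ Y =
      ∑ p : κ × ι, negMulLog (μ.real (W ⁻¹' {p.1}) * μ.real (Y ⁻¹' {p.2})) := by
    simp only [negMulLog_mul, Finset.sum_add_distrib, Fintype.sum_prod_type]
    simp only [← Finset.mul_sum, ← Finset.sum_mul, sum_real_preimage μ hW, sum_real_preimage μ hY,
      one_mul, ent]
  rw [e]
  refine tendsto_finsetSum _ fun p _ => (continuous_negMulLog.tendsto _).comp ?_
  have := h𝓕 _ _ (hY (measurableSet_singleton p.2)) (hW (measurableSet_singleton p.1))
  refine this.congr fun g => congrArg _ ?_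
  ext x
  simp [Prod.ext_iff]

end Labels

/-! ### Construction of the sequence and the two implications. -/

section Construction

open Topology

/-- A sequence defined recursively from its finite initial segments. -/
def seqOfInitial {α : Type*} (next : ∀ n, (Fin n → α) → α) (n : ℕ) : α :=
  next n fun i => seqOfInitial next i
termination_by n
decreasing_by exact i.2

lemma seqOfInitial_eq {α : Type*} (next : ∀ n, (Fin n → α) → α) (n : ℕ) :
    seqOfInitial next n = next n fun i => seqOfInitial next i := by
  rw [seqOfInitial]

lemma limsup_coe_le_of_le {u : ℕ → ℝ} {c C : ℝ} (h : ∀ k : ℕ, 0 < k → u k ≤ C / k + c) :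
    limsup (fun k => ((u k : ℝ) : EReal)) atTop ≤ (c : EReal) := by
  have hlim : Tendsto (fun k : ℕ => ((C / k + c : ℝ) : EReal)) atTop (𝓝 (c : EReal)) := by
    refine (continuous_coe_real_ereal.tendsto _).comp ?_
    simpa using (tendsto_const_div_atTop_nhds_zero_nat C).add_const c
  rw [← hlim.limsup_eq]
  refine limsup_le_limsup ?_
  filter_upwards [eventually_gt_atTop 0] with k hk
  exact_mod_cast h k hk

lemma le_limsup_coe_of_le {u : ℕ → ℝ} {c C : ℝ} (h : ∀ k : ℕ, 0 < k → C / k + c ≤ u k) :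
    (c : EReal) ≤ limsup (fun k => ((u k : ℝ) : EReal)) atTop := by
  have hlim : Tendsto (fun k : ℕ => ((C / k + c : ℝ) : EReal)) atTop (𝓝 (c : EReal)) := by
    refine (continuous_coe_real_ereal.tendsto _).comp ?_
    simpa using (tendsto_const_div_atTop_nhds_zero_nat C).add_const c
  rw [← hlim.limsup_eq]
  refine limsup_le_limsup ?_
  filter_upwards [eventually_gt_atTop 0] with k hk
  exact_mod_cast h k hk

lemma linear_le_of_increments {u : ℕ → ℝ} {c : ℝ} {j : ℕ} (hc : 0 ≤ c) (h0 : ∀ k, 0 ≤ u k)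
    (h : ∀ k, j < k → u k + c - (1 / 2) ^ k ≤ u (k + 1)) (k : ℕ) :
    k * c - ((j + 1) * c + 2) ≤ u k := by
  -- The term `2 * (1 / 2) ^ n` is the reserve that pays for the remaining geometric losses.
  have key : ∀ n : ℕ, n * c - 2 + 2 * (1 / 2) ^ n ≤ u (j + 1 + n) := by
    intro n
    induction n with
    | zero => simpa using h0 (j + 1)
    | succ n ih =>
      have h1 := h (j + 1 + n) (by omega)
      have h2 : (1 / 2 : ℝ) ^ (j + 1 + n) ≤ (1 / 2) ^ n :=
        pow_le_pow_of_le_one (by norm_num) (by norm_num) (by omega)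
      rw [← add_assoc, pow_succ]
      push_cast
      linarith
  rcases le_total k (j + 1) with hk | hk
  · have : (k : ℝ) ≤ j + 1 := by exact_mod_cast hk
    nlinarith [h0 k]
  · obtain ⟨n, rfl⟩ := Nat.exists_eq_add_of_le hk
    have := key n
    have h3 : (0 : ℝ) < (1 / 2) ^ n := by positivity
    push_cast
    linarith

variable {X ι : Type*} [MeasurableSpace X] [AddAction (ℤ × ℤ) X] [MeasurableConstVAdd (ℤ × ℤ) X]
  (μ : Measure X) [IsProbabilityMeasure μ] [VAddInvariantMeasure (ℤ × ℤ) X μ]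

/-- In a weakly mixing system, a sequence of lattice points in a strip along which countably many
finite-valued functions are asymptotically independent. -/
lemma exists_asymptotically_independent_sequence {β b₀ b : ℝ} (hb : 0 < b)
    (hwm : IsWeakMixing μ β b₀) (r : ℕ → ℕ) (Y : ∀ j, X → Fin (r j + 1))
    (hY : ∀ j, Measurable (Y j)) :
    ∃ S : ℕ → ℤ × ℤ, (∀ k, S k ∈ strip β b) ∧ StrictMono (fun k => (S k).1) ∧
      ∀ j k, j < k → ent μ (fun x (i : Fin k) => Y j (S i +ᵥ x)) + ent μ (Y j) - (1 / 2) ^ k ≤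
        ent μ (fun x (i : Fin (k + 1)) => Y j (S i +ᵥ x)) := by
  obtain ⟨𝓕, hne, hstrip, hgt, hmix⟩ := exists_mixing_filter μ hb hwm
  have step : ∀ (k : ℕ) (s : Fin k → ℤ × ℤ), ∃ g : ℤ × ℤ, g ∈ strip β b ∧ (∀ i, (s i).1 < g.1) ∧
      ∀ j : Fin k, ent μ (fun x (i : Fin k) => Y j (s i +ᵥ x)) + ent μ (Y j) - (1 / 2) ^ k <
        ent μ (fun x => (fun i : Fin k => Y j (s i +ᵥ x), Y j (g +ᵥ x))) := by
    intro k s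
    -- At stage `k` only the first `k` functions are treated, so finitely many eventual conditions
    -- must hold at once.
    refine Eventually.exists (f := 𝓕) (hstrip.and ((eventually_all.mpr fun i => hgt (s i).1).and
      (eventually_all.mpr fun j => ?_)))
    refine (tendsto_ent_of_mixing μ hmix (W := fun x (i : Fin k) => Y j (s i +ᵥ x))
      (measurable_pi_lambda _ fun i => measurable_comp_vadd (hY j) (s i)) (hY j)).eventually
      (lt_mem_nhds ?_)
    have : (0 : ℝ) < (1 / 2) ^ k := by positivity
    linarith
  choose next h1 h2 h3 using step
  refine ⟨seqOfInitial next, fun k => ?_, strictMono_nat_of_lt_succ fun k => ?_, fun j k hjk => ?_⟩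
  · rw [seqOfInitial_eq]; exact h1 _ _
  · rw [seqOfInitial_eq next (k + 1)]
    exact h2 (k + 1) (fun i => seqOfInitial next i) (Fin.last k)
  · rw [ent_fin_succ μ (Y := fun i x => Y j (seqOfInitial next i +ᵥ x))
      (fun i => measurable_comp_vadd (hY j) _)]
    have := h3 k (fun i => seqOfInitial next i) ⟨j, hjk⟩
    rw [← seqOfInitial_eq next k] at this
    exact this.le

/-- The direct implication: weak mixing provides a sequence of full entropy. -/
theorem exists_sequence_of_isWeakMixing [MeasurableSpace.CountablyGenerated X] {β b₀ b : ℝ}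
    (hb : 0 < b) (hwm : IsWeakMixing μ β b₀) :
    ∃ S : ℕ → ℤ × ℤ, IsStripSequence β b S ∧ ∀ (r : ℕ) (α : MeasurablePartition (Fin r) X),
      sequenceEntropy μ α S = ((α.entropy μ : ℝ) : EReal) := by
  choose 𝒴 h𝒴 hdense using exists_dense_labels μ
  obtain ⟨S, hS, hmono, hind⟩ := exists_asymptotically_independent_sequence μ hb hwm
    -- Pairing merges the dense families for all numbers of cells into one sequence.
    (fun j => j.unpair.1) (fun j => 𝒴 j.unpair.1 j.unpair.2) (fun j => h𝒴 _ _)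
  refine ⟨S, ⟨hS, Or.inl hmono⟩, fun r α => ?_⟩
  have hX : Nonempty X := μ.nonempty_of_neZero
  obtain ⟨r, rfl⟩ : ∃ r', r = r' + 1 :=
    Nat.exists_eq_succ_of_ne_zero fun h => by
      subst h; exact (α.label hX.some).elim0
  rw [MeasurablePartition.entropy_eq_ent, sequenceEntropy]
  simp only [sequenceJoin_entropy]
  set Y := α.label
  have hY : Measurable Y := α.measurable_label
  have hYS : ∀ j, Measurable fun x => Y (S j +ᵥ x) := fun j => measurable_comp_vadd hY (S j)
  refine le_antisymm (limsup_coe_le_of_le (C := 0) fun k hk => ?_) ?_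
  · have h := ent_fin_le_sum μ hYS k
    simp only [ent_comp_measurePreserving μ (fun i => hY (measurableSet_singleton i))
      (measurePreserving_vadd _ μ), Finset.sum_const, Finset.card_range, nsmul_eq_mul] at h
    rw [zero_div, zero_add, div_le_iff₀ (by positivity), mul_comm]
    exact h
  · refine EReal.ge_of_forall_gt_iff_ge.mp fun z hz => ?_
    have hz' : 0 < (ent μ Y - z) / 2 := by
      have : z < ent μ Y := by exact_mod_cast hz
      linarith
    -- Replacing `Y` by `Z` costs `H(Y | Z)` once and `H(Z | Y)` per term, each below half the gap.
    set ε := (ent μ Y - z) / 2 with hε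
    obtain ⟨δ, hδ, hcond⟩ := exists_condEnt_lt (Fin (r + 1)) μ hz'
    obtain ⟨n, hn⟩ := hdense r Y hY δ hδ
    set Z := 𝒴 r n
    have hZ : Measurable Z := h𝒴 r n
    have c1 := hcond Z Y hZ hY hn
    have c2 := hcond Y Z hY hZ (by simpa only [ne_comm] using hn)
    have hZS : ∀ j, Measurable fun x => Z (S j +ᵥ x) := fun j => measurable_comp_vadd hZ (S j)
    have hlin := fun k => linear_le_of_increments (j := Nat.pair r n)
      (u := fun k => ent μ fun x (i : Fin k) => Z (S i +ᵥ x)) (c := ent μ Z) (ent_nonneg μ)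
      (fun k => ent_nonneg μ) (fun k hk => by
        have := hind (Nat.pair r n) k hk
        rw [Nat.unpair_pair] at this
        exact this) k
    refine le_limsup_coe_of_le (C := -((Nat.pair r n + 1) * ent μ Z + 2)) fun k hk => ?_
    have h := ent_fin_le μ hZS hYS k
    simp only [condEnt_comp_measurePreserving μ hZ hY (measurePreserving_vadd _ μ),
      Finset.sum_const, Finset.card_range, nsmul_eq_mul] at h
    have hk' : (0 : ℝ) < k := by exact_mod_cast hk
    have h5 := ent_le_ent_add_condEnt μ hY hZ
    have h6 : (k : ℝ) * z ≤ k * (ent μ Z - condEnt μ Z Y) := by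
      gcongr
      linarith
    rw [le_div_iff₀ hk', add_mul, div_mul_cancel₀ _ hk'.ne']
    have := hlin k
    linarith

/-- The partition into a set and its complement. -/
def partitionOfSet {B : Set X} (hB : MeasurableSet B) : MeasurablePartition (Fin 2) X where
  cell := ![B, Bᶜ]
  measurableSet_cell i := by fin_cases i <;> simp [hB]
  disjoint_cell i j hij := by
    fin_cases i <;> fin_cases j <;> simp_all [disjoint_compl_right, disjoint_compl_left]
  iUnion_cell := by
    ext x
    simp [em]

/-- The converse implication: a sequence of full entropy forces weak mixing. -/
theorem isWeakMixing_of_sequence {β b₀ b : ℝ} (hb₀ : 0 < b₀) {S : ℕ → ℤ × ℤ}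
    (hS : ∀ i, S i ∈ strip β b) (h : ∀ α : MeasurablePartition (Fin 2) X,
      sequenceEntropy μ α S = ((α.entropy μ : ℝ) : EReal)) :
    IsWeakMixing μ β b₀ := by
  intro B hBK
  obtain ⟨hB, hBb₀⟩ := (mem_kroneckerAlgebra_iff μ).mp hBK
  have hBb := totallyBounded_orbit_of_strip μ hb₀ b hBb₀
  set α := partitionOfSet hB
  set Y := α.label
  have hY : Measurable Y := α.measurable_label
  have hYB : ∀ x, Y x = 0 ↔ x ∈ B := fun x => α.label_eq_iff
  have hle : ∀ ε > 0, α.entropy μ ≤ ε := by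
    intro ε hε
    obtain ⟨δ, hδ, hcond⟩ := exists_condEnt_lt (Fin 2) μ hε
    -- Squared `L²` distance of indicators is the measure of the symmetric difference, hence the
    -- radius `√δ`.
    obtain ⟨G, -, hG⟩ := exists_finset_net hBb (Real.sqrt_pos.mpr hδ)
    choose γ hγ hγd using fun i => hG (S i) (hS i)
    rw [← EReal.coe_le_coe_iff, ← h α, sequenceEntropy]
    simp only [sequenceJoin_entropy]
    -- All the approximants `Y (γ j +ᵥ x)` are read off from the finitely many translates in `G`, so
    -- their join has entropy bounded independently of `k`.
    refine limsup_coe_le_of_le (C := Fintype.card (G → Fin 2)) fun k hk => ?_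
    have hk' : (0 : ℝ) < k := by exact_mod_cast hk
    have h1 := ent_fin_le μ (fun j => measurable_comp_vadd hY (S j))
      (fun j => measurable_comp_vadd hY (γ j)) k
    have h2 : ent μ (fun x (j : Fin k) => Y (γ j +ᵥ x)) ≤ Fintype.card (G → Fin 2) :=
      (ent_comp_le μ (Y := fun x (g : G) => Y (g.1 +ᵥ x))
        (measurable_pi_lambda _ fun g => measurable_comp_vadd hY g.1)
        (fun v (j : Fin k) => v ⟨γ j, hγ j⟩)).trans (ent_le_card μ)
    have h3 : ∑ j ∈ Finset.range k, condEnt μ (fun x => Y (S j +ᵥ x)) (fun x => Y (γ j +ᵥ x)) ≤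
        k * ε := by
      refine (Finset.sum_le_sum fun j _ => (hcond _ _ (measurable_comp_vadd hY (S j))
        (measurable_comp_vadd hY (γ j)) ?_).le).trans (by simp)
      have h4 : dist (koopman μ (S j) (ind μ hB)) (koopman μ (γ j) (ind μ hB)) ^ 2 < δ :=
        (pow_lt_pow_left₀ (hγd j) dist_nonneg two_ne_zero).trans_eq (Real.sq_sqrt hδ.le)
      rw [koopman_ind, koopman_ind, dist_ind_sq] at h4
      refine lt_of_le_of_lt (measureReal_mono fun x hx => ?_) h4
      have e1 := hYB (S j +ᵥ x)
      have e2 := hYB (γ j +ᵥ x)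
      rw [Set.mem_symmDiff, Set.mem_preimage, Set.mem_preimage, ← e1, ← e2]
      simp only [Set.mem_ofPred_eq] at hx
      omega
    rw [div_le_iff₀ hk', add_mul, div_mul_cancel₀ _ hk'.ne']
    linarith
  have h0 : α.entropy μ ≤ 0 := le_of_forall_pos_le_add fun ε hε => by simpa using hle ε hε
  have hcell : ∀ i, 0 ≤ Real.negMulLog (μ.real (α.cell i)) := fun i =>
    Real.negMulLog_nonneg measureReal_nonneg measureReal_le_one
  have hz : Real.negMulLog (μ.real B) ≤ 0 :=
    (Finset.single_le_sum (fun i _ => hcell i) (Finset.mem_univ (0 : Fin 2))).trans h0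
  have hz0 : Real.negMulLog (μ.real B) = 0 := le_antisymm hz (hcell 0)
  rw [Real.negMulLog, neg_mul, neg_eq_zero, mul_eq_zero, Real.log_eq_zero] at hz0
  have hnn : 0 ≤ μ.real B := measureReal_nonneg
  -- `Real.log` vanishes at `0`, `1` and `-1`; nonnegativity excludes the last.
  rcases hz0 with hz0 | hz0 | hz0 | hz0
  · exact Or.inl (ae_eq_empty.mpr ((measureReal_eq_zero_iff).mp hz0))
  · exact Or.inl (ae_eq_empty.mpr ((measureReal_eq_zero_iff).mp hz0))
  · refine Or.inr (ae_eq_univ.mpr ?_)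
    rw [← measureReal_eq_zero_iff, probReal_compl_eq_one_sub hB, hz0, sub_self]
  · linarith

end Construction

end DirectionalWeakMixing

end

/-- For a `ℤ²`-action by homeomorphisms of a compact metric space with an invariant Borel
probability measure: weak mixing in direction `(1, β)` is equivalent to the existence of one
sequence in the strip of width `b` along which the sequence entropy of every finite measurable
partition equals the entropy of the partition. The width `b₀` used in the definition of the
directional Kronecker algebra is arbitrary and unrelated to `b`. -/
theorem mainTheorem3 {X : Type*} [MetricSpace X] [CompactSpace X] [MeasurableSpace X]
    [BorelSpace X] [AddAction (ℤ × ℤ) X] [ContinuousConstVAdd (ℤ × ℤ) X]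
    (μ : MeasureTheory.Measure X) [MeasureTheory.IsProbabilityMeasure μ]
    [MeasureTheory.VAddInvariantMeasure (ℤ × ℤ) X μ]
    (β : ℝ) (b₀ : ℝ) (hb₀ : 0 < b₀) (b : ℝ) (hb : 0 < b) :
    DirectionalWeakMixing.IsWeakMixing μ β b₀ ↔
      ∃ S : ℕ → ℤ × ℤ, DirectionalWeakMixing.IsStripSequence β b S ∧
        ∀ (r : ℕ) (α : DirectionalWeakMixing.MeasurablePartition (Fin r) X),
          DirectionalWeakMixing.sequenceEntropy μ α S = ((α.entropy μ : ℝ) : EReal) := by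
  refine ⟨fun h => DirectionalWeakMixing.exists_sequence_of_isWeakMixing μ hb h, ?_⟩
  rintro ⟨S, hS, h⟩
  exact DirectionalWeakMixing.isWeakMixing_of_sequence μ hb₀ hS.1 (h 2)
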